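/- Let $g\ge 1$ and let $\Gamma$ be a chain of $g$ cycles: the metric graph made of $g$ cycles of arbitrary lengths, the $i$-th one carrying two distinct points $v_i\neq w_i$, in which $w_i$ is joined to $v_{i+1}$ by a bridge of length $\ge 0$ for $1\le i<g$ (a bridge of length $0$ means $w_i=v_{i+1}$). Let $\ell_i$ be the length of the $i$-th cycle and $\ell(v_iw_i)$ the length of its clockwise edge from $v_i$ to $w_i$. The torsion order $m_i$ is the least positive integer $m$ such that $m\,\ell(v_iw_i)\in\mathbf Z\,\ell_i$, and $m_i=0$ if there is none; put $\underline m=(m_2,\dots,m_g)$. Identify a partition $\lambda=(\lambda_0\ge\lambda_1\ge\cdots)$ with its set of boxes $\{(x,y)\in\mathbf Z_{>0}^2: x\le\lambda_{y-1}\}$, whose number is $|\lambda|$. Let $$W^\lambda(\Gamma,w_g)=\{[D]\in\operatorname{Pic}^0(\Gamma):\ r(D+d\,w_g)\ge r\ \text{ for all } d,r\in\mathbf Z \text{ with } (g-d+r,\,r+1)\in\lambda\},$$ where $r(\cdot)$ is the Baker–Norine rank; the dimension of a subset of the $g$-dimensional real torus $\operatorname{Pic}^0(\Gamma)$ is the Hausdorff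 dimension of its inverse image in the universal cover $\mathbf R^g$. An $\underline m$-displacement tableau on $\lambda$ is a function $t:\lambda\to\{1,\dots,g\}$ that is strictly increasing along every row and every column and satisfies $x-y\equiv x'-y' \pmod{m_{t(x,y)}}$ for any two distinct boxes with $t(x,y)=t(x',y')$. The symbols omitted by $t$ are the elements of $\{1,\dots,g\}$ that are not values of $t$. Then, for every partition $\lambda$: 1. $W^\lambda(\Gamma,w_g)$ is nonempty if and only if there is an $\underline m$-displacement tableau on $\lambda$. 2. If $W^\lambda(\Gamma,w_g)$ is nonempty, then its dimension, which is also the dimension of its largest component, is equal to the maximum number of omitted symbols in an $\underline m$-displacement tableau on $\lambda$. 3. If $W^\lambda(\Gamma,w_g)$ is nonempty, then this dimension is equal to $g-|\lambda|$ if and only if no $\underline m$-displacement tableau on $\lambda$ has a repeated symbol. -/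

import Mathlib

open Set

noncomputable section

/-- A finite metric graph, presented by finitely many vertices and finitely many oriented edges
with lengths.  An edge of length zero is contracted to a point. -/
structure MetricGraph where
  V : Type
  E : Type
  [finV : Finite V]
  [finE : Fintype E]
  src : E → V
  tgt : E → V
  len : E → ℝ
  len_nonneg : ∀ e, 0 ≤ len e

attribute [instance] MetricGraph.finV MetricGraph.finE

namespace MetricGraph

variable (Γ : MetricGraph)

/-- The generating gluings: the two ends of the segment `[0, len e]` are glued to the source and
the target of the edge `e`. -/
inductive Glue : Γ.V ⊕ (Σ e : Γ.E, Icc (0 : ℝ) (Γ.len e)) →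
    Γ.V ⊕ (Σ e : Γ.E, Icc (0 : ℝ) (Γ.len e)) → Prop
  | src (e : Γ.E) : Glue (Sum.inl (Γ.src e)) (Sum.inr ⟨e, ⟨0, le_refl _, Γ.len_nonneg e⟩⟩)
  | tgt (e : Γ.E) : Glue (Sum.inl (Γ.tgt e)) (Sum.inr ⟨e, ⟨Γ.len e, Γ.len_nonneg e, le_refl _⟩⟩)

/-- The points of the metric graph. -/
def Point : Type := Quot Γ.Glue

/-- A vertex as a point of the metric graph. -/
def vertex (v : Γ.V) : Γ.Point := Quot.mk _ (Sum.inl v)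

/-- A point of the segment of an edge as a point of the metric graph. -/
def onEdge (x : Σ e : Γ.E, Icc (0 : ℝ) (Γ.len e)) : Γ.Point := Quot.mk _ (Sum.inr x)

/-- The point of the edge `e` at distance `t` from its source, for `0 ≤ t ≤ len e` (other real
numbers `t` are first moved to the nearest end of `[0, len e]`). -/
def pt (e : Γ.E) (t : ℝ) : Γ.Point := Γ.onEdge ⟨e, projIcc 0 (Γ.len e) (Γ.len_nonneg e) t⟩

/-- The quotient topology: a set is open when it meets every edge in an open set. -/
instance : TopologicalSpace Γ.Point := TopologicalSpace.coinduced Γ.onEdge inferInstance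

/-- The genus (first Betti number) of a connected metric graph. -/
def genus : ℤ := (Nat.card Γ.E : ℤ) - Nat.card Γ.V + 1

/-- Divisors on the metric graph. -/
abbrev Div : Type := Γ.Point →₀ ℤ

/-- The degree of a divisor. -/
def deg : Γ.Div →+ ℤ := Finsupp.degree

variable {Γ}

/-- `h` is, on `[0, ℓ]`, the continuous piecewise linear function with integer slopes that starts
with slope `s` and whose slope jumps by `b u` at `u`, for finitely many `u` in `(0, ℓ)`. -/
def IsPL (ℓ : ℝ) (h : ℝ → ℝ) (s : ℤ) (b : ℝ →₀ ℤ) : Prop :=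
  (∀ u ∈ b.support, u ∈ Ioo 0 ℓ) ∧
    ∀ t ∈ Icc 0 ℓ, h t = h 0 + s * t + b.sum fun u k => (k : ℝ) * max (t - u) 0

/-- The contribution of the edge `e` to the divisor of a rational function which on `e` has
initial slope `s` and slope jumps `b`: at each point of the closed edge, the sum of the outgoing
slopes along `e`. -/
def edgeDiv (e : Γ.E) (s : ℤ) (b : ℝ →₀ ℤ) : Γ.Div :=
  Finsupp.single (Γ.pt e 0) s + b.mapDomain (Γ.pt e)
    - Finsupp.single (Γ.pt e (Γ.len e)) (s + b.sum fun _ k => k)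

variable (Γ)

/-- `D` is the divisor of a rational function: of a continuous function on the metric graph which
is piecewise linear with integer slopes on every edge.  The coefficient of a point is the sum of
the outgoing slopes there. -/
def IsPrincipal (D : Γ.Div) : Prop :=
  ∃ (f : Γ.Point → ℝ) (s : Γ.E → ℤ) (b : Γ.E → (ℝ →₀ ℤ)),
    (∀ e, IsPL (Γ.len e) (fun t => f (Γ.pt e t)) (s e) (b e)) ∧
      D = ∑ e, edgeDiv e (s e) (b e)

theorem isPrincipal_zero : Γ.IsPrincipal 0 := by
  refine ⟨0, 0, 0, fun e => ⟨by simp, by simp⟩, ?_⟩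
  simp [edgeDiv]

theorem sum_smul_max_add (b b' : ℝ →₀ ℤ) (t : ℝ) :
    ((b + b').sum fun u k => (k : ℝ) * max (t - u) 0) =
      (b.sum fun u k => (k : ℝ) * max (t - u) 0) + b'.sum fun u k => (k : ℝ) * max (t - u) 0 :=
  Finsupp.sum_add_index' (by simp) (by intros; push_cast; ring)

theorem edgeDiv_add (e : Γ.E) (s s' : ℤ) (b b' : ℝ →₀ ℤ) :
    edgeDiv e (s + s') (b + b') = edgeDiv e s b + edgeDiv e s' b' := by
  have h : ((b + b').sum fun _ k => k) = (b.sum fun _ k => k) + b'.sum fun _ k => k :=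
    Finsupp.sum_add_index' (by simp) (by simp)
  simp only [edgeDiv, h, Finsupp.mapDomain_add, Finsupp.single_add]
  abel

theorem IsPrincipal.add {D D' : Γ.Div} (h : Γ.IsPrincipal D) (h' : Γ.IsPrincipal D') :
    Γ.IsPrincipal (D + D') := by
  obtain ⟨f, s, b, h1, rfl⟩ := h
  obtain ⟨f', s', b', h1', rfl⟩ := h'
  refine ⟨f + f', s + s', b + b', fun e => ⟨fun u hu => ?_, fun t ht => ?_⟩, ?_⟩
  · rcases Finset.mem_union.1 (Finsupp.support_add hu) with hu | hu
    · exact (h1 e).1 u hu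
    · exact (h1' e).1 u hu
  · have e1 := (h1 e).2 t ht
    have e2 := (h1' e).2 t ht
    simp only [Pi.add_apply] at *
    rw [sum_smul_max_add, e1, e2]
    push_cast
    ring
  · simp [edgeDiv_add, Finset.sum_add_distrib]

theorem IsPrincipal.neg {D : Γ.Div} (h : Γ.IsPrincipal D) : Γ.IsPrincipal (-D) := by
  obtain ⟨f, s, b, h1, rfl⟩ := h
  refine ⟨-f, -s, -b, fun e => ⟨fun u hu => ?_, fun t ht => ?_⟩, ?_⟩
  · exact (h1 e).1 u (by simpa using hu)
  · have e1 := (h1 e).2 t ht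
    have e2 := sum_smul_max_add (b e) (-(b e)) t
    simp only [add_neg_cancel, Finsupp.sum_zero_index] at e2
    simp only [Pi.neg_apply] at *
    rw [e1]
    push_cast
    linarith
  · rw [← Finset.sum_neg_distrib]
    refine Finset.sum_congr rfl fun e _ => ?_
    have := edgeDiv_add Γ e (s e) (-(s e)) (b e) (-(b e))
    rw [add_neg_cancel, add_neg_cancel] at this
    have h0 : edgeDiv e 0 (0 : ℝ →₀ ℤ) = (0 : Γ.Div) := by simp [edgeDiv]
    rw [h0] at this
    exact (eq_neg_of_add_eq_zero_right this.symm).symm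

/-- The group of principal divisors. -/
def Prin : AddSubgroup Γ.Div where
  carrier := {D | Γ.IsPrincipal D}
  zero_mem' := Γ.isPrincipal_zero
  add_mem' h h' := IsPrincipal.add Γ h h'
  neg_mem' h := IsPrincipal.neg Γ h

theorem deg_edgeDiv (e : Γ.E) (s : ℤ) (b : ℝ →₀ ℤ) : Γ.deg (edgeDiv e s b) = 0 := by
  have h : Γ.deg (b.mapDomain (Γ.pt e)) = b.sum fun _ k => k := by
    change ((b.mapDomain (Γ.pt e)).sum fun _ k => k) = _
    rw [Finsupp.sum_mapDomain_index (by simp) (by simp)]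
  have h2 (p : Γ.Point) (k : ℤ) : Γ.deg (Finsupp.single p k) = k := by simp [deg]
  simp only [edgeDiv, map_sub, map_add, h, h2]
  ring

/-- Divisors modulo linear equivalence. -/
abbrev Pic : Type := Γ.Div ⧸ Γ.Prin

/-- The class of a divisor. -/
def cls : Γ.Div →+ Γ.Pic := QuotientAddGroup.mk' Γ.Prin

/-- The degree of a divisor class. -/
def degPic : Γ.Pic →+ ℤ := QuotientAddGroup.lift Γ.Prin Γ.deg (by
  rintro D ⟨f, s, b, -, rfl⟩
  simp [deg_edgeDiv])

theorem degPic_cls (D : Γ.Div) : Γ.degPic (Γ.cls D) = Γ.deg D := rfl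

/-- The group of divisor classes of degree zero. -/
def Pic0 : Type := Γ.degPic.ker

instance : AddCommGroup Γ.Pic0 := inferInstanceAs (AddCommGroup Γ.degPic.ker)

/-- The inclusion of the classes of degree zero into all classes. -/
def Pic0.toPic : Γ.Pic0 →+ Γ.Pic := Γ.degPic.ker.subtype

/-- The class of `p 1 + ... + p n - q 1 - ... - q n`. -/
def diffClass (n : ℕ) (x : (Fin n → Γ.Point) × (Fin n → Γ.Point)) : Γ.Pic0 :=
  ⟨Γ.cls (∑ i, (Finsupp.single (x.1 i) 1 - Finsupp.single (x.2 i) 1)), by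
    rw [AddMonoidHom.mem_ker, degPic_cls, map_sum]
    simp [deg]⟩

/-- The topology of the tropical Jacobian: the finest one for which, for every `n`, the class of
`p 1 + ... + p n - q 1 - ... - q n` depends continuously on the points. -/
instance : TopologicalSpace Γ.Pic0 :=
  ⨆ n : ℕ, TopologicalSpace.coinduced (Γ.diffClass n) inferInstance

variable {Γ}

/-- A class is effective if it contains an effective divisor. -/
def IsEffective (c : Γ.Pic) : Prop := ∃ E : Γ.Div, 0 ≤ E ∧ Γ.cls E = c

/-- The Baker-Norine rank: the largest integer `r` such that `c - [E]` is effective for all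
effective divisors `E` of degree `r`.  (All negative integers qualify, and `0` qualifies exactly
when `c` is effective, so the rank is at least `-1`, and it is `-1` if `c` is not effective.) -/
def rank (c : Γ.Pic) : ℤ :=
  sSup {r : ℤ | ∀ E : Γ.Div, 0 ≤ E → Γ.deg E = r → IsEffective (c - Γ.cls E)}

theorem deg_nonneg {E : Γ.Div} (h : 0 ≤ E) : 0 ≤ Γ.deg E := by
  exact Finset.sum_nonneg fun p _ => h p

/-- The supremum in the definition of the rank is attained. -/
theorem le_rank_iff [Nonempty Γ.Point] (c : Γ.Pic) (r : ℤ) :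
    r ≤ rank c ↔ ∀ E : Γ.Div, 0 ≤ E → Γ.deg E = r → IsEffective (c - Γ.cls E) := by
  obtain ⟨p⟩ := ‹Nonempty Γ.Point›
  have hdeg (k : ℤ) : Γ.deg (Finsupp.single p k) = k := by simp [deg]
  have hpos (k : ℤ) (hk : 0 ≤ k) : (0 : Γ.Div) ≤ Finsupp.single p k := by
    simpa using hk
  set S : Set ℤ := {r | ∀ E : Γ.Div, 0 ≤ E → Γ.deg E = r → IsEffective (c - Γ.cls E)} with hS
  have hne : S.Nonempty := ⟨-1, fun E h h' => by have := deg_nonneg h; omega⟩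
  have hbd : BddAbove S := by
    refine ⟨max 0 (Γ.degPic c), fun k hk => ?_⟩
    by_contra hlt
    rw [not_le, max_lt_iff] at hlt
    obtain ⟨F, hF, hF'⟩ := hk _ (hpos k hlt.1.le) (hdeg k)
    have h1 := congrArg Γ.degPic hF'
    rw [map_sub, degPic_cls, degPic_cls, hdeg] at h1
    have := deg_nonneg hF
    omega
  constructor
  · intro h E hE hEr
    have hmax : rank c ∈ S := Int.csSup_mem hne hbd
    obtain ⟨F, hF, hF'⟩ := hmax (E + Finsupp.single p (rank c - r))
      (add_nonneg hE (hpos _ (by omega))) (by rw [map_add, hdeg, hEr]; ring)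
    refine ⟨F + Finsupp.single p (rank c - r), add_nonneg hF (hpos _ (by omega)), ?_⟩
    rw [map_add, hF', map_add]
    abel
  · exact fun h => le_csSup hbd h

/-- `(x, y)`, with `x, y ≥ 1`, is a box of the Young diagram (French notation): it lies in the
`x`-th column and the `y`-th row, that is `x ≤ λ_{y-1}`. -/
def HasBox (μ : YoungDiagram) (x y : ℤ) : Prop :=
  ∃ i j : ℕ, (i, j) ∈ μ ∧ x = j + 1 ∧ y = i + 1

/-- The Brill-Noether locus of the marked metric graph `(Γ, w)` and a partition. -/
def brillNoetherLocus (w : Γ.Point) (μ : YoungDiagram) : Set Γ.Pic0 :=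
  {c | ∀ d r : ℤ, HasBox μ (Γ.genus - d + r) (r + 1) →
    r ≤ rank (Pic0.toPic Γ c + d • Γ.cls (Finsupp.single w 1))}

/-- The nonempty subset `W` of the real torus `Pic0` has dimension `k`: its inverse image under
the universal covering homomorphism `ℝ ^ n → Pic0` has Hausdorff dimension `k`.  (The universal
covering homomorphism is unique up to a linear automorphism of `ℝ ^ n`, and these preserve
the Hausdorff dimension.) -/
def HasDimension (W : Set Γ.Pic0) (k : ℕ) : Prop :=
  W.Nonempty ∧ ∃ (n : ℕ) (π : (Fin n → ℝ) →+ Γ.Pic0),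
    IsLocalHomeomorph π ∧ Function.Surjective π ∧ dimH (π ⁻¹' W) = k

end MetricGraph

/-- A chain of `g` cycles.  The `i`-th cycle carries two distinct points `v i` and `w i`; the
clockwise edge from `v i` to `w i` has length `vw i`, the clockwise edge from `w i` to `v i` has
length `wv i`.  A bridge of length `bridge i` connects `w i` to `v (i + 1)`; if its length is zero,
the two points coincide.  Indices start at `0`. -/
structure ChainOfCycles (g : ℕ) where
  vw : Fin g → ℝ
  wv : Fin g → ℝ
  bridge : Fin (g - 1) → ℝ
  vw_pos : ∀ i, 0 < vw i
  wv_pos : ∀ i, 0 < wv i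
  bridge_nonneg : ∀ i, 0 ≤ bridge i

namespace ChainOfCycles

variable {g : ℕ} (C : ChainOfCycles g)

/-- The chain as a metric graph.  Vertices: `inl i` is `v i`, `inr i` is `w i`.  Edges:
`inl (inl i)` runs clockwise from `v i` to `w i`, `inl (inr i)` runs clockwise from `w i` to `v i`,
and `inr i` is the bridge from `w i` to `v (i + 1)`. -/
def graph : MetricGraph where
  V := Fin g ⊕ Fin g
  E := (Fin g ⊕ Fin g) ⊕ Fin (g - 1)
  src := Sum.elim (Sum.elim Sum.inl Sum.inr) fun i => Sum.inr ⟨i, by omega⟩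
  tgt := Sum.elim (Sum.elim Sum.inr Sum.inl) fun i => Sum.inl ⟨i + 1, by omega⟩
  len := Sum.elim (Sum.elim C.vw C.wv) C.bridge
  len_nonneg := by
    rintro ((i | i) | i)
    · exact (C.vw_pos i).le
    · exact (C.wv_pos i).le
    · exact C.bridge_nonneg i

/-- The marked point: the point `w` of the last cycle. -/
def lastPoint (hg : 0 < g) : C.graph.Point := C.graph.vertex (Sum.inr ⟨g - 1, by omega⟩)

/-- The torsion order of the `i`-th cycle: the least positive integer `m` such that `m * vw i` is
an integer multiple of the length of the cycle, and `0` if there is none, that is if `vw i` is an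
irrational multiple of that length. -/
def torsion (i : Fin g) : ℕ := sInf {m : ℕ | 0 < m ∧ ∃ k : ℤ, m * C.vw i = k * (C.vw i + C.wv i)}

end ChainOfCycles

/-- `t` is an `m`-displacement tableau on `μ`.  The symbols `1, ..., g` are numbered from `0` here.
The box in row `i` and column `j` (numbered from `0`) is `(x, y) = (j + 1, i + 1)`, so
`x - y = j - i`.  The value `m 0`, which is not part of the torsion profile, plays no role, since
the smallest symbol cannot occur twice in a tableau with strictly increasing rows and columns. -/
structure IsDisplacementTableau {g : ℕ} (m : Fin g → ℕ) (μ : YoungDiagram)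
    (t : μ.cells → Fin g) : Prop where
  row : ∀ a b : μ.cells, a.1.1 = b.1.1 → a.1.2 < b.1.2 → t a < t b
  col : ∀ a b : μ.cells, a.1.2 = b.1.2 → a.1.1 < b.1.1 → t a < t b
  torsion : ∀ a b : μ.cells, a ≠ b → t a = t b →
    (a.1.2 : ℤ) - a.1.1 ≡ (b.1.2 : ℤ) - b.1.1 [ZMOD m (t a)]

/-- The number of symbols which do not occur in the tableau. -/
def omittedCount {g : ℕ} {μ : YoungDiagram} (t : μ.cells → Fin g) : ℕ := (range t)ᶜ.ncard

end

noncomputable section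

/-! ### Building principal divisors from slopes on the edges. -/

namespace MetricGraph

variable {Γ : MetricGraph}

/-! The locus is a finite union of coordinate subtori, one for each displacement tableau `t`; the
codimension of each is the number of distinct symbols of `t`. All three assertions follow by
counting.

Retracting the graph to each cycle in turn gives every divisor one coordinate in each circle.
Principal divisors have zero coordinates, and degree and coordinates determine the class
(`pic_ext`), so `Pic0` is a product of circles (`pic0Homeomorph`).

Effectivity becomes a count of chips (`isEffective_iff`). Let `S k` be the number of chips on the
cycles from the `k`-th on. A chip on cycle `i` lets the coordinate there take any value; without one
the coordinate must be `S (i + 1) • posW i`, since later chips retract to `w i` and earlier ones to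
`v i`.

The rank is then decided by a game (`le_rank_iff_growth`): going from the last cycle to the first,
an adversary distributes the chips to be subtracted and a defender pays for an effective remainder.
The position of the game is a box `(x, y)`. Passing cycle `k` for free requires a coincidence of
coordinates, which depends only on the diagonal `x - y`. So `r ≤ rank` says that a certain box is
reached by a region growing out of the complement of the quadrant, where step `k` adds the addable
boxes on the diagonals that satisfy the coincidence.

Recording the step at which each box is added turns growth into a tableau (`forall_growth_iff`), and
the coincidences used say exactly that the class lies on the torus of this tableau
(`mem_brillNoetherLocus_iff`). Equal symbols prescribe the same coordinate exactly under the torsion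
congruence. -/

theorem pt_of_mem (e : Γ.E) {t : ℝ} (ht : t ∈ Icc 0 (Γ.len e)) : Γ.pt e t = Γ.onEdge ⟨e, t, ht⟩ := by
  rw [pt, projIcc_of_mem _ ht]

theorem pt_zero (e : Γ.E) : Γ.pt e 0 = Γ.vertex (Γ.src e) := by
  rw [pt_of_mem e (left_mem_Icc.2 (Γ.len_nonneg e))]
  exact (Quot.sound (Glue.src e)).symm

theorem pt_len (e : Γ.E) : Γ.pt e (Γ.len e) = Γ.vertex (Γ.tgt e) := by
  rw [pt_of_mem e (right_mem_Icc.2 (Γ.len_nonneg e))]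
  exact (Quot.sound (Glue.tgt e)).symm

theorem continuous_pt (e : Γ.E) : Continuous (Γ.pt e) :=
  continuous_coinduced_rng.comp (continuous_sigmaMk.comp continuous_projIcc)

@[simp] theorem deg_single (p : Γ.Point) (k : ℤ) : Γ.deg (Finsupp.single p k) = k := by
  simp [deg]

/-- Slope changes at the two ends of an edge can be absorbed into the initial slope. -/
theorem exists_eq_add_single_ends {ℓ : ℝ} (b : ℝ →₀ ℤ)
    (hb : ∀ u ∈ b.support, u ∈ Icc 0 ℓ) :
    ∃ (b' : ℝ →₀ ℤ) (j k : ℤ), (∀ u ∈ b'.support, u ∈ Ioo 0 ℓ) ∧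
      b = b' + Finsupp.single 0 j + Finsupp.single ℓ k := by
  classical
  -- For `ℓ = 0` the two ends coincide, and the jump there must be counted only once.
  refine ⟨b.filter (· ∈ Ioo 0 ℓ), b 0, if ℓ = 0 then 0 else b ℓ, fun u hu => ?_, ?_⟩
  · rw [Finsupp.support_filter, Finset.mem_filter] at hu
    exact hu.2
  · ext u
    have hu : u ∉ Icc 0 ℓ → b u = 0 := fun h => by
      by_contra h0
      exact h (hb u (Finsupp.mem_support_iff.2 h0))
    simp only [Finsupp.add_apply, Finsupp.filter_apply, Finsupp.single_apply]
    by_cases h : u ∈ Ioo 0 ℓ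
    · have h1 : 0 ≠ u := h.1.ne
      have h2 : ℓ ≠ u := h.2.ne'
      simp [h, h1, h2]
    · by_cases h0 : 0 = u
      · subst h0
        by_cases hl : ℓ = 0 <;> simp [hl]
      · by_cases hl : ℓ = u
        · subst hl
          simp [h0, Ne.symm h0]
        · have : u ∉ Icc 0 ℓ := fun hI =>
            h ⟨lt_of_le_of_ne hI.1 h0, lt_of_le_of_ne hI.2 (Ne.symm hl)⟩
          simp [h, h0, hl, hu this]

theorem sum_mul_single_add (b : ℝ →₀ ℤ) (φ : ℝ → ℝ) (v : ℝ) (j : ℤ) :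
    (b + Finsupp.single v j).sum (fun u k => (k : ℝ) * φ u) =
      b.sum (fun u k => (k : ℝ) * φ u) + j * φ v := by
  rw [Finsupp.sum_add_index' (by simp) (by intros; push_cast; ring),
    Finsupp.sum_single_index (by simp)]

theorem sum_single_add (b : ℝ →₀ ℤ) (v : ℝ) (j : ℤ) :
    (b + Finsupp.single v j).sum (fun _ k => k) = b.sum (fun _ k => k) + j := by
  rw [Finsupp.sum_add_index' (by simp) (by simp), Finsupp.sum_single_index rfl]

/-- Values at the vertices, initial slopes and slope changes that fit together define a principal
divisor. -/
theorem isPrincipal_of_edges (F : Γ.V → ℝ) (s : Γ.E → ℤ) (b : Γ.E → (ℝ →₀ ℤ))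
    (hb : ∀ e, ∀ u ∈ (b e).support, u ∈ Icc 0 (Γ.len e))
    (hF : ∀ e, F (Γ.tgt e) = F (Γ.src e) + s e * Γ.len e +
      (b e).sum fun u k => (k : ℝ) * (Γ.len e - u)) :
    Γ.IsPrincipal (∑ e, edgeDiv e (s e) (b e)) := by
  choose b' j k hb' hbe using fun e => exists_eq_add_single_ends (b e) (hb e)
  have hmax (e : Γ.E) (t : ℝ) (ht : t ≤ 0) :
      ((b e).sum fun u k => (k : ℝ) * max (t - u) 0) = 0 := by
    refine Finset.sum_eq_zero fun u hu => ?_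
    have := (hb e u hu).1
    change _ * max (t - u) 0 = 0
    rw [max_eq_right (by linarith), mul_zero]
  -- The function integrates the slopes from the source of each edge; `hF` makes it agree with `F`
  -- at the target.
  let val : Γ.V ⊕ (Σ e : Γ.E, Icc (0 : ℝ) (Γ.len e)) → ℝ := Sum.elim F fun x =>
    F (Γ.src x.1) + s x.1 * (x.2 : ℝ) + (b x.1).sum fun u k => (k : ℝ) * max ((x.2 : ℝ) - u) 0
  have hval : ∀ x y, Γ.Glue x y → val x = val y := by
    rintro _ _ (e | e)
    · have := hmax e 0 le_rfl
      simp only [zero_sub] at this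
      simp [val, this]
    · simp only [val, Sum.elim_inl, Sum.elim_inr, hF e]
      congr 1
      refine Finset.sum_congr rfl fun u hu => ?_
      have := (hb e u hu).2
      change _ = _ * max (Γ.len e - u) 0
      rw [max_eq_left (by linarith)]
  -- A jump at `0` joins the initial slope. A jump at the far end does not affect the function and
  -- cancels in `edgeDiv`.
  refine ⟨Quot.lift val hval, fun e => s e + j e, b', fun e => ⟨hb' e, fun t ht => ?_⟩, ?_⟩
  · have h0 : (0 : ℝ) ∈ Icc 0 (Γ.len e) := left_mem_Icc.2 (Γ.len_nonneg e)
    simp only [pt_of_mem e ht, pt_of_mem e h0]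
    change F (Γ.src e) + s e * t + _ = (F (Γ.src e) + s e * (0 : ℝ) + _) + _ + _
    dsimp only
    rw [hmax e 0 le_rfl, hbe e, sum_mul_single_add _ (fun u => max (t - u) 0),
      sum_mul_single_add _ (fun u => max (t - u) 0), max_eq_left (by linarith [ht.1]),
      max_eq_right (by linarith [ht.2])]
    push_cast
    ring
  · refine Finset.sum_congr rfl fun e _ => ?_
    rw [hbe e]
    simp only [edgeDiv, sum_single_add, Finsupp.mapDomain_add, Finsupp.mapDomain_single]
    rw [show s e + ((b' e).sum (fun _ k => k) + j e + k e) =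
      (s e + j e + (b' e).sum fun _ k => k) + k e by ring, Finsupp.single_add _ _ (k e),
      Finsupp.single_add _ (s e) (j e)]
    abel

@[simp] theorem edgeDiv_zero (e : Γ.E) : edgeDiv e 0 (0 : ℝ →₀ ℤ) = (0 : Γ.Div) := by
  simp [edgeDiv]

theorem cls_eq_zero_iff {D : Γ.Div} : Γ.cls D = 0 ↔ Γ.IsPrincipal D :=
  QuotientAddGroup.eq_zero_iff D

end MetricGraph

/-! ### Principal divisors supported on one cycle or one bridge. -/

namespace ChainOfCycles

open MetricGraph

variable {g : ℕ} (C : ChainOfCycles g)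

/-- The length of the `i`-th cycle. -/
def length (i : Fin g) : ℝ := C.vw i + C.wv i

theorem length_pos (i : Fin g) : 0 < C.length i := add_pos (C.vw_pos i) (C.wv_pos i)

instance (i : Fin g) : Fact (0 < C.length i) := ⟨C.length_pos i⟩

/-- The point `v i`. -/
def ptV (i : Fin g) : C.graph.Point := C.graph.vertex (Sum.inl i)

/-- The point `w i`. -/
def ptW (i : Fin g) : C.graph.Point := C.graph.vertex (Sum.inr i)

/-- The clockwise edge from `v i` to `w i`. -/
def edgeVW (i : Fin g) : C.graph.E := Sum.inl (Sum.inl i)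

/-- The clockwise edge from `w i` to `v i`. -/
def edgeWV (i : Fin g) : C.graph.E := Sum.inl (Sum.inr i)

/-- The bridge from `w i` to `v (i + 1)`. -/
def edgeBridge (i : Fin (g - 1)) : C.graph.E := Sum.inr i

/-- The point of the `i`-th cycle at clockwise distance `t ∈ [0, length i]` from `v i`. -/
def cyclePt (i : Fin g) (t : ℝ) : C.graph.Point :=
  if t ≤ C.vw i then C.graph.pt (C.edgeVW i) t else C.graph.pt (C.edgeWV i) (t - C.vw i)

theorem pt_edgeVW_zero (i : Fin g) : C.graph.pt (C.edgeVW i) 0 = C.ptV i := pt_zero _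

theorem pt_edgeVW_len (i : Fin g) : C.graph.pt (C.edgeVW i) (C.vw i) = C.ptW i :=
  pt_len (C.edgeVW i)

theorem pt_edgeWV_zero (i : Fin g) : C.graph.pt (C.edgeWV i) 0 = C.ptW i := pt_zero _

theorem pt_edgeWV_len (i : Fin g) : C.graph.pt (C.edgeWV i) (C.wv i) = C.ptV i :=
  pt_len (C.edgeWV i)

@[simp] theorem cyclePt_zero (i : Fin g) : C.cyclePt i 0 = C.ptV i := by
  rw [cyclePt, if_pos (C.vw_pos i).le, pt_edgeVW_zero]

@[simp] theorem cyclePt_vw (i : Fin g) : C.cyclePt i (C.vw i) = C.ptW i := by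
  rw [cyclePt, if_pos le_rfl, pt_edgeVW_len]

@[simp] theorem cyclePt_length (i : Fin g) : C.cyclePt i (C.length i) = C.ptV i := by
  rw [cyclePt, if_neg (by have := C.wv_pos i; simp only [length]; linarith), length,
    add_sub_cancel_left, pt_edgeWV_len]

theorem continuous_cyclePt (i : Fin g) : Continuous (C.cyclePt i) := by
  refine Continuous.if_le (continuous_pt _) ((continuous_pt _).comp (by fun_prop))
    continuous_id continuous_const fun t ht => ?_
  rw [show t = C.vw i from ht, pt_edgeVW_len]
  simp [pt_edgeWV_zero]

theorem sum_edges {M : Type*} [AddCommMonoid M] (φ : C.graph.E → M) :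
    ∑ e, φ e = ∑ i, φ (C.edgeVW i) + ∑ i, φ (C.edgeWV i) + ∑ i, φ (C.edgeBridge i) := by
  exact (Fintype.sum_sum_type (α₁ := Fin g ⊕ Fin g) (α₂ := Fin (g - 1)) φ).trans
    (congrArg (· + _) (Fintype.sum_sum_type fun i : Fin g ⊕ Fin g => φ (Sum.inl i)))

/-- Abel's theorem on one of the cycles. -/
theorem isPrincipal_cycle (i : Fin g) (n : ℝ →₀ ℤ) (hn : ∀ u ∈ n.support, u ∈ Icc 0 (C.length i))
    (hdeg : (n.sum fun _ k => k) = 0) (σ : ℤ)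
    (hσ : σ * C.length i = n.sum fun u k => (k : ℝ) * u) :
    C.graph.IsPrincipal (n.mapDomain (C.cyclePt i)) := by
  classical
  set a := C.vw i with ha
  set b₁ := n.filter (· ≤ a) with hb₁
  set c₂ := n.filter (fun u => ¬ u ≤ a) with hc₂
  have hsplit : b₁ + c₂ = n := Finsupp.filter_add_filter_not n _
  set b₂ := c₂.mapDomain (fun u => u - a) with hb₂
  -- The function starts at `v i` with slope `σ` and value `0`. It reaches `w i` with value `fa` and
  -- goes on with slope `τ`. The moment condition `hσ` closes it up at `v i`, and `hdeg` makes the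
  -- final slope `σ` again.
  set τ := σ + b₁.sum fun _ k => k with hτ
  set fa : ℝ := σ * a + b₁.sum fun u k => (k : ℝ) * (a - u) with hfa
  have hlen : C.length i = a + C.wv i := rfl
  have hb₁s : ∀ u ∈ b₁.support, u ∈ Icc 0 a := fun u hu => by
    rw [hb₁, Finsupp.support_filter, Finset.mem_filter] at hu
    exact ⟨(hn u hu.1).1, hu.2⟩
  have hc₂s : ∀ u ∈ c₂.support, u ∈ Icc 0 (C.length i) ∧ ¬ u ≤ a := fun u hu => by
    rw [hc₂, Finsupp.support_filter, Finset.mem_filter] at hu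
    exact ⟨hn u hu.1, hu.2⟩
  have hb₂s : ∀ u ∈ b₂.support, u ∈ Icc 0 (C.wv i) := fun u hu => by
    obtain ⟨v, hv, rfl⟩ := Finset.mem_image.1 (Finsupp.mapDomain_support hu)
    have := hc₂s v hv
    have h1 := this.1.2
    rw [hlen] at h1
    exact ⟨by linarith [not_le.1 this.2], by linarith⟩
  have hdeg' : (b₁.sum fun _ k => k) + (c₂.sum fun _ k => k) = 0 := by
    rw [← Finsupp.sum_add_index' (by simp) (by simp), hsplit, hdeg]
  have hσ' : (b₁.sum fun u k => (k : ℝ) * u) + (c₂.sum fun u k => (k : ℝ) * u) =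
      σ * C.length i := by
    rw [← Finsupp.sum_add_index' (by simp) (by intros; push_cast; ring), hsplit, hσ]
  have hlin (b : ℝ →₀ ℤ) (ℓ : ℝ) : (b.sum fun u k => (k : ℝ) * (ℓ - u)) =
      ℓ * ((b.sum fun _ k => k : ℤ) : ℝ) - b.sum fun u k => (k : ℝ) * u := by
    simp only [Finsupp.sum, Int.cast_sum, Finset.mul_sum, ← Finset.sum_sub_distrib]
    exact Finset.sum_congr rfl fun u _ => by ring
  have hb₂d : (b₂.sum fun _ k => k) = c₂.sum fun _ k => k := by
    rw [hb₂, Finsupp.sum_mapDomain_index (by simp) (by simp)]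
  have hb₂m : (b₂.sum fun u k => (k : ℝ) * (C.wv i - u)) =
      c₂.sum fun u k => (k : ℝ) * (C.length i - u) := by
    rw [hb₂, Finsupp.sum_mapDomain_index (by simp) (by intros; push_cast; ring)]
    exact Finset.sum_congr rfl fun u _ => by rw [hlen]; ring
  -- Off the cycle the function is constant: `0` before it and `fa` behind it.
  let F : C.graph.V → ℝ := Sum.elim (fun j => if i < j then fa else 0)
    (fun j => if i ≤ j then fa else 0)
  let s : C.graph.E → ℤ := Sum.elim (Sum.elim (fun j => if j = i then σ else 0)
    (fun j => if j = i then τ else 0)) 0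
  let b : C.graph.E → (ℝ →₀ ℤ) := Sum.elim (Sum.elim (fun j => if j = i then b₁ else 0)
    (fun j => if j = i then b₂ else 0)) 0
  have hs₁ (j) : s (C.edgeVW j) = if j = i then σ else 0 := rfl
  have hs₂ (j) : s (C.edgeWV j) = if j = i then τ else 0 := rfl
  have hbe₁ (j) : b (C.edgeVW j) = if j = i then b₁ else 0 := rfl
  have hbe₂ (j) : b (C.edgeWV j) = if j = i then b₂ else 0 := rfl
  have key := isPrincipal_of_edges F s b ?_ ?_
  · convert key using 1
    rw [C.sum_edges, Finset.sum_eq_single i, Finset.sum_eq_single i]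
    · have hB (j) : edgeDiv (C.edgeBridge j) (s (C.edgeBridge j)) (b (C.edgeBridge j)) = 0 :=
        edgeDiv_zero _
      rw [hs₁, hs₂, hbe₁, hbe₂, if_pos rfl, if_pos rfl, if_pos rfl, if_pos rfl,
        Finset.sum_eq_zero fun j _ => hB j, add_zero]
      have e1 : n.mapDomain (C.cyclePt i) = b₁.mapDomain (C.graph.pt (C.edgeVW i)) +
          b₂.mapDomain (C.graph.pt (C.edgeWV i)) := by
        rw [hb₂, ← Finsupp.mapDomain_comp]
        nth_rw 1 [← hsplit]
        rw [Finsupp.mapDomain_add]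
        congr 1
        · refine Finsupp.mapDomain_congr fun u hu => ?_
          rw [cyclePt, if_pos (hb₁s u hu).2]
        · refine Finsupp.mapDomain_congr fun u hu => ?_
          rw [cyclePt, if_neg (hc₂s u hu).2]
          rfl
      have e2 : τ + (b₂.sum fun _ k => k) = σ := by rw [hb₂d, hτ]; linarith
      rw [edgeDiv, edgeDiv, e1, ← hτ, e2]
      change _ = Finsupp.single (C.graph.pt (C.edgeVW i) 0) σ + _ -
        Finsupp.single (C.graph.pt (C.edgeVW i) (C.vw i)) τ +
        (Finsupp.single (C.graph.pt (C.edgeWV i) 0) τ + _ -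
        Finsupp.single (C.graph.pt (C.edgeWV i) (C.wv i)) σ)
      rw [pt_edgeVW_zero, pt_edgeVW_len, pt_edgeWV_zero, pt_edgeWV_len]
      abel
    · intro j _ hj
      rw [hs₂, hbe₂, if_neg hj, if_neg hj, edgeDiv_zero]
    · simp
    · intro j _ hj
      rw [hs₁, hbe₁, if_neg hj, if_neg hj, edgeDiv_zero]
    · simp
  · rintro ((j | j) | j)
    · change ∀ u ∈ (if j = i then b₁ else 0 : ℝ →₀ ℤ).support, u ∈ Icc 0 (C.vw j)
      split_ifs with h
      · subst h; exact hb₁s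
      · simp
    · change ∀ u ∈ (if j = i then b₂ else 0 : ℝ →₀ ℤ).support, u ∈ Icc 0 (C.wv j)
      split_ifs with h
      · subst h; exact hb₂s
      · simp
    · simp [b]
  · rintro ((j | j) | j)
    · change (if i ≤ j then fa else 0) = (if i < j then fa else 0) +
        ((if j = i then σ else 0 : ℤ) : ℝ) * C.vw j +
        (if j = i then b₁ else 0 : ℝ →₀ ℤ).sum fun u k => (k : ℝ) * (C.vw j - u)
      by_cases h : j = i
      · subst h; simp [hfa]
        rfl
      · have : i ≤ j ↔ i < j := ⟨fun hh => lt_of_le_of_ne hh (Ne.symm h), le_of_lt⟩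
        simp [h, this]
    · change (if i < j then fa else 0) = (if i ≤ j then fa else 0) +
        ((if j = i then τ else 0 : ℤ) : ℝ) * C.wv j +
        (if j = i then b₂ else 0 : ℝ →₀ ℤ).sum fun u k => (k : ℝ) * (C.wv j - u)
      by_cases h : j = i
      · subst h
        simp only [lt_irrefl, if_false, le_refl, if_true]
        rw [hb₂m, hlin, hfa, hlin, hτ]
        have h1 : ((b₁.sum fun _ k => k : ℤ) : ℝ) + ((c₂.sum fun _ k => k : ℤ) : ℝ) = 0 := by
          exact_mod_cast hdeg'
        have h2 : ((c₂.sum fun _ k => k : ℤ) : ℝ) = - ((b₁.sum fun _ k => k : ℤ) : ℝ) := by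
          linarith
        rw [h2]
        rw [hlen] at hσ' ⊢
        push_cast
        linear_combination hσ'
      · have : i ≤ j ↔ i < j := ⟨fun hh => lt_of_le_of_ne hh (Ne.symm h), le_of_lt⟩
        simp [h, this]
    · change (if i < (⟨j + 1, _⟩ : Fin g) then fa else 0) =
        (if i ≤ (⟨j, _⟩ : Fin g) then fa else 0) + ((0 : ℤ) : ℝ) * C.bridge j +
        (0 : ℝ →₀ ℤ).sum fun u k => (k : ℝ) * (C.bridge j - u)
      simp [Fin.lt_def, Fin.le_def]

/-- Points of a bridge are linearly equivalent to its source. -/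
theorem isPrincipal_bridge (i : Fin (g - 1)) {t : ℝ} (ht : t ∈ Icc 0 (C.bridge i)) :
    C.graph.IsPrincipal (Finsupp.single (C.graph.pt (C.edgeBridge i) t) 1 -
      Finsupp.single (C.graph.pt (C.edgeBridge i) 0) 1) := by
  classical
  -- The function descends with slope `-1` along the bridge up to `t` and is constant elsewhere.
  let F : C.graph.V → ℝ := Sum.elim (fun j => if (i : ℕ) < j then -t else 0)
    (fun j => if (i : ℕ) < j then -t else 0)
  let s : C.graph.E → ℤ := Sum.elim 0 (fun j => if j = i then -1 else 0)
  let b : C.graph.E → (ℝ →₀ ℤ) := Sum.elim 0 (fun j => if j = i then Finsupp.single t 1 else 0)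
  have hs (j) : s (C.edgeBridge j) = if j = i then -1 else 0 := rfl
  have hbe (j) : b (C.edgeBridge j) = if j = i then Finsupp.single t 1 else 0 := rfl
  have key := isPrincipal_of_edges F s b ?_ ?_
  · convert key using 1
    rw [C.sum_edges, Finset.sum_eq_zero, Finset.sum_eq_zero, Finset.sum_eq_single i]
    · rw [hs, hbe, if_pos rfl, if_pos rfl, edgeDiv, Finsupp.mapDomain_single, zero_add,
        Finsupp.sum_single_index rfl, neg_add_cancel, Finsupp.single_zero, Finsupp.single_neg]
      abel
    · intro j _ hj
      rw [hs, hbe, if_neg hj, if_neg hj, edgeDiv_zero]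
    · simp
    · intro j _
      exact edgeDiv_zero _
    · intro j _
      exact edgeDiv_zero _
  · rintro ((j | j) | j)
    · simp [b]
    · simp [b]
    · change ∀ u ∈ (if j = i then Finsupp.single t 1 else 0 : ℝ →₀ ℤ).support,
        u ∈ Icc 0 (C.bridge j)
      split_ifs with h
      · subst h
        intro u hu
        rw [Finset.mem_singleton.1 (Finsupp.support_single_subset hu)]
        exact ht
      · simp
  · rintro ((j | j) | j)
    · change (if (i : ℕ) < j then -t else 0) = (if (i : ℕ) < j then -t else 0) + ((0 : ℤ) : ℝ) * _ +
        (0 : ℝ →₀ ℤ).sum _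
      simp
    · change (if (i : ℕ) < j then -t else 0) = (if (i : ℕ) < j then -t else 0) + ((0 : ℤ) : ℝ) * _ +
        (0 : ℝ →₀ ℤ).sum _
      simp
    · change (if (i : ℕ) < j + 1 then -t else 0) = (if (i : ℕ) < j then -t else 0) +
        ((if j = i then -1 else 0 : ℤ) : ℝ) * C.bridge j +
        (if j = i then Finsupp.single t 1 else 0 : ℝ →₀ ℤ).sum
          fun u k => (k : ℝ) * (C.bridge j - u)
      by_cases h : j = i
      · subst h
        simp
        ring
      · have : (i : ℕ) < j + 1 ↔ (i : ℕ) < j := by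
          have : (j : ℕ) ≠ i := fun hh => h (Fin.ext hh)
          omega
        simp [h, this]

end ChainOfCycles

/-! ### Retractions to the cycles and coordinates of divisors. -/

namespace MetricGraph

variable {Γ : MetricGraph}

/-- The linear extension to divisors of a map from the points to an abelian group. -/
def divLift {G : Type*} [AddCommGroup G] (ρ : Γ.Point → G) : Γ.Div →+ G :=
  Finsupp.liftAddHom fun p => (smulAddHom ℤ G).flip (ρ p)

@[simp] theorem divLift_single {G : Type*} [AddCommGroup G] (ρ : Γ.Point → G) (p : Γ.Point)
    (k : ℤ) : divLift ρ (Finsupp.single p k) = k • ρ p := by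
  simp [divLift]

/-- Summation by parts: the degree of `edgeDiv` is zero, which removes `c`, and its first moment is
the drop of `h` along the edge. -/
theorem divLift_edgeDiv {G : Type*} [AddCommGroup G] (ρ : Γ.Point → G) (e : Γ.E) (c : G)
    (φ : ℝ →+ G) (hρ : ∀ t ∈ Icc 0 (Γ.len e), ρ (Γ.pt e t) = c + φ t) {h : ℝ → ℝ} {s : ℤ}
    {b : ℝ →₀ ℤ} (hh : IsPL (Γ.len e) h s b) :
    divLift ρ (edgeDiv e s b) = φ (h 0 - h (Γ.len e)) := by
  have h0 : (0 : ℝ) ∈ Icc 0 (Γ.len e) := left_mem_Icc.2 (Γ.len_nonneg e)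
  have h1 : Γ.len e ∈ Icc 0 (Γ.len e) := right_mem_Icc.2 (Γ.len_nonneg e)
  have hb : divLift ρ (b.mapDomain (Γ.pt e)) =
      (b.sum fun _ k => k) • c + φ (b.sum fun u k => (k : ℝ) * u) := by
    rw [Finsupp.mapDomain, Finsupp.sum, map_sum]
    simp only [divLift_single, Finsupp.sum, map_sum, Finset.sum_smul, ← Finset.sum_add_distrib]
    refine Finset.sum_congr rfl fun u hu => ?_
    rw [hρ u (Ioo_subset_Icc_self (hh.1 u hu)), smul_add, ← map_zsmul, zsmul_eq_mul]
  have hs : (b.sum fun u k => (k : ℝ) * max (Γ.len e - u) 0) =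
      ((b.sum fun _ k => k : ℤ) : ℝ) * Γ.len e - b.sum fun u k => (k : ℝ) * u := by
    simp only [Finsupp.sum, Int.cast_sum, Finset.sum_mul, ← Finset.sum_sub_distrib]
    refine Finset.sum_congr rfl fun u hu => ?_
    rw [max_eq_left (by linarith [(hh.1 u hu).2])]
    ring
  rw [edgeDiv, map_sub, map_add, divLift_single, divLift_single, hb, hρ 0 h0, hρ _ h1,
    hh.2 _ h1, hs, map_zero, add_zero, smul_add, ← map_zsmul, zsmul_eq_mul]
  have : h 0 - (h 0 + s * Γ.len e + (((b.sum fun _ k => k : ℤ) : ℝ) * Γ.len e -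
      b.sum fun u k => (k : ℝ) * u)) = (b.sum fun u k => (k : ℝ) * u) -
      ((s + b.sum fun _ k => k : ℤ) : ℝ) * Γ.len e := by
    push_cast
    ring
  rw [this, map_sub, add_smul]
  abel

end MetricGraph

namespace ChainOfCycles

open MetricGraph

variable {g : ℕ} (C : ChainOfCycles g)

/-- The position of `w i` on the `i`-th cycle. -/
def posW (i : Fin g) : AddCircle (C.length i) := (C.vw i : ℝ)

/-- The retraction to the `i`-th cycle in terms of the edges: points before the cycle are sent to
`v i` and points behind it are sent to `w i`. -/
def edgeRetract (i : Fin g) : C.graph.E → ℝ → AddCircle (C.length i) :=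
  Sum.elim (Sum.elim
    (fun j t => if j = i then (t : AddCircle (C.length i)) else if i < j then C.posW i else 0)
    (fun j t => if j = i then C.posW i + (t : AddCircle (C.length i))
      else if i < j then C.posW i else 0))
    (fun j _ => if (i : ℕ) ≤ j then C.posW i else 0)

/-- The retraction to the `i`-th cycle. -/
def retract (i : Fin g) : C.graph.Point → AddCircle (C.length i) :=
  Quot.lift (Sum.elim (Sum.elim (fun j => if i < j then C.posW i else 0)
    (fun j => if i ≤ j then C.posW i else 0)) fun x => C.edgeRetract i x.1 x.2) (by
  have hlen : C.posW i + ((C.wv i : ℝ) : AddCircle (C.length i)) = 0 := by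
    rw [posW, ← AddCircle.coe_add]
    exact AddCircle.coe_period (C.length i)
  rintro _ _ (((j | j) | j) | ((j | j) | j))
  · change (if i < j then C.posW i else 0) =
      if j = i then ((0 : ℝ) : AddCircle (C.length i)) else if i < j then C.posW i else 0
    by_cases h : j = i
    · subst h; simp
    · simp [h]
  · change (if i ≤ j then C.posW i else 0) = if j = i then
      C.posW i + ((0 : ℝ) : AddCircle (C.length i)) else if i < j then C.posW i else 0
    by_cases h : j = i
    · subst h; simp
    · simp [h, lt_iff_le_and_ne, Ne.symm h]
  · change (if i ≤ ⟨j, _⟩ then C.posW i else 0) = if (i : ℕ) ≤ j then C.posW i else 0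
    rfl
  · change (if i ≤ j then C.posW i else 0) = if j = i then
      ((C.vw j : ℝ) : AddCircle (C.length i)) else if i < j then C.posW i else 0
    by_cases h : j = i
    · subst h; simp [posW]
    · simp [h, lt_iff_le_and_ne, Ne.symm h]
  · change (if i < j then C.posW i else 0) = if j = i then
      C.posW i + ((C.wv j : ℝ) : AddCircle (C.length i)) else if i < j then C.posW i else 0
    by_cases h : j = i
    · subst h; simp [hlen]
    · simp [h]
  · change (if i < ⟨j + 1, _⟩ then C.posW i else 0) = if (i : ℕ) ≤ j then C.posW i else 0
    simp [Fin.lt_def])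

theorem retract_pt (i : Fin g) (e : C.graph.E) {t : ℝ} (ht : t ∈ Icc 0 (C.graph.len e)) :
    C.retract i (C.graph.pt e t) = C.edgeRetract i e t := by
  rw [pt_of_mem e ht]
  rfl

theorem retract_ptV (i j : Fin g) : C.retract i (C.ptV j) = if i < j then C.posW i else 0 := rfl

theorem retract_ptW (i j : Fin g) : C.retract i (C.ptW j) = if i ≤ j then C.posW i else 0 := rfl

theorem edgeRetract_edgeVW (i j : Fin g) (t : ℝ) : C.edgeRetract i (C.edgeVW j) t =
    if j = i then (t : AddCircle (C.length i)) else if i < j then C.posW i else 0 := rfl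

theorem edgeRetract_edgeWV (i j : Fin g) (t : ℝ) : C.edgeRetract i (C.edgeWV j) t =
    if j = i then C.posW i + (t : AddCircle (C.length i)) else if i < j then C.posW i else 0 := rfl

theorem edgeRetract_edgeBridge (i : Fin g) (j : Fin (g - 1)) (t : ℝ) :
    C.edgeRetract i (C.edgeBridge j) t = if (i : ℕ) ≤ j then C.posW i else 0 := rfl

theorem continuous_edgeRetract (i : Fin g) (e : C.graph.E) : Continuous (C.edgeRetract i e) := by
  rcases e with (j | j) | j
  · change Continuous fun t : ℝ => if j = i then (t : AddCircle (C.length i)) else _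
    split_ifs
    exacts [AddCircle.continuous_mk' _, continuous_const, continuous_const]
  · change Continuous fun t : ℝ => if j = i then C.posW i + (t : AddCircle (C.length i)) else _
    split_ifs
    exacts [continuous_const.add (AddCircle.continuous_mk' _), continuous_const, continuous_const]
  · exact continuous_const

theorem continuous_retract (i : Fin g) : Continuous (C.retract i) := by
  rw [continuous_coinduced_dom, continuous_sigma_iff]
  exact fun e => (C.continuous_edgeRetract i e).comp continuous_subtype_val

theorem retract_cyclePt (i j : Fin g) {t : ℝ} (ht : t ∈ Icc 0 (C.length j)) :
    C.retract i (C.cyclePt j t) =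
      if j = i then (t : AddCircle (C.length i)) else if i < j then C.posW i else 0 := by
  rw [cyclePt]
  split_ifs with h1 h2 h3 h2 h3
  all_goals first
    | rw [retract_pt _ _ _ (show t ∈ Icc 0 (C.vw j) from ⟨ht.1, h1⟩), edgeRetract_edgeVW]
    | rw [retract_pt _ _ _ (show t - C.vw j ∈ Icc 0 (C.wv j) from ⟨by linarith, by
        have := ht.2
        rw [length] at this
        linarith⟩), edgeRetract_edgeWV]
  all_goals simp [*, posW]

/-- The coordinates of a divisor: the sums of the retractions of its points. -/
def coord (i : Fin g) : C.graph.Div →+ AddCircle (C.length i) := divLift (C.retract i)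

/-- The retraction is constant on every edge off the `i`-th cycle, so only its two arcs contribute,
and the drops of `f` from `v i` to `w i` and back cancel. -/
theorem coord_eq_zero_of_isPrincipal {D : C.graph.Div} (hD : C.graph.IsPrincipal D) (i : Fin g) :
    C.coord i D = 0 := by
  obtain ⟨f, s, b, h, rfl⟩ := hD
  rw [map_sum, C.sum_edges]
  have h1 (j : Fin g) (hj : j ≠ i) :
      C.coord i (edgeDiv (C.edgeVW j) (s (C.edgeVW j)) (b (C.edgeVW j))) = 0 := by
    refine (divLift_edgeDiv (C.retract i) _ (if i < j then C.posW i else 0) 0 (fun t ht => ?_)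
      (h _)).trans rfl
    rw [C.retract_pt i _ ht, edgeRetract_edgeVW, if_neg hj, AddMonoidHom.zero_apply, add_zero]
  have h2 (j : Fin g) (hj : j ≠ i) :
      C.coord i (edgeDiv (C.edgeWV j) (s (C.edgeWV j)) (b (C.edgeWV j))) = 0 := by
    refine (divLift_edgeDiv (C.retract i) _ (if i < j then C.posW i else 0) 0 (fun t ht => ?_)
      (h _)).trans rfl
    rw [C.retract_pt i _ ht, edgeRetract_edgeWV, if_neg hj, AddMonoidHom.zero_apply, add_zero]
  have h3 (j : Fin (g - 1)) :
      C.coord i (edgeDiv (C.edgeBridge j) (s (C.edgeBridge j)) (b (C.edgeBridge j))) = 0 := by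
    refine (divLift_edgeDiv (C.retract i) _ (if (i : ℕ) ≤ j then C.posW i else 0) 0
      (fun t ht => ?_) (h _)).trans rfl
    rw [C.retract_pt i _ ht, edgeRetract_edgeBridge, AddMonoidHom.zero_apply, add_zero]
  rw [Finset.sum_eq_single i (fun j _ => h1 j) (by simp),
    Finset.sum_eq_single i (fun j _ => h2 j) (by simp), Finset.sum_eq_zero fun j _ => h3 j,
    add_zero]
  let coe : ℝ →+ AddCircle (C.length i) := QuotientAddGroup.mk' _
  have e1 := divLift_edgeDiv (C.retract i) (C.edgeVW i) 0 coe (fun t ht => by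
    rw [C.retract_pt i _ ht, edgeRetract_edgeVW, if_pos rfl, zero_add]; rfl) (h _)
  have e2 := divLift_edgeDiv (C.retract i) (C.edgeWV i) (C.posW i) coe (fun t ht => by
    rw [C.retract_pt i _ ht, edgeRetract_edgeWV, if_pos rfl]; rfl) (h _)
  change divLift _ _ + divLift _ _ = 0
  rw [e1, e2, ← map_add]
  change coe (f (C.graph.pt (C.edgeVW i) 0) - f (C.graph.pt (C.edgeVW i) (C.vw i)) +
    (f (C.graph.pt (C.edgeWV i) 0) - f (C.graph.pt (C.edgeWV i) (C.wv i)))) = 0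
  rw [pt_edgeVW_zero, pt_edgeWV_zero, pt_edgeVW_len, pt_edgeWV_len, sub_add_sub_cancel, sub_self,
    map_zero]

/-! ### Divisor classes are determined by degree and coordinates. -/

/-- The `i`-th cycle, parametrized clockwise from `v i`. -/
def loop (i : Fin g) : AddCircle (C.length i) → C.graph.Point :=
  AddCircle.liftIco (C.length i) 0 (C.cyclePt i)

theorem continuous_loop (i : Fin g) : Continuous (C.loop i) :=
  AddCircle.liftIco_continuous (by rw [zero_add, cyclePt_zero, cyclePt_length])
    (C.continuous_cyclePt i).continuousOn

theorem loop_coe (i : Fin g) {t : ℝ} (ht : t ∈ Icc 0 (C.length i)) :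
    C.loop i t = C.cyclePt i t := by
  rcases ht.2.lt_or_eq with h | h
  · exact AddCircle.liftIco_coe_apply (by rw [zero_add]; exact ⟨ht.1, h⟩)
  · rw [h, cyclePt_length, AddCircle.coe_period, ← C.cyclePt_zero]
    exact AddCircle.liftIco_coe_apply (x := (0 : ℝ))
      (by rw [zero_add]; exact ⟨le_rfl, C.length_pos i⟩)

theorem exists_coe_eq (i : Fin g) (x : AddCircle (C.length i)) :
    ∃ t ∈ Icc 0 (C.length i), (t : AddCircle (C.length i)) = x := by
  have h := (AddCircle.equivIco (C.length i) 0 x).2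
  exact ⟨_, ⟨h.1, h.2.le.trans_eq (zero_add _)⟩, AddCircle.coe_equivIco⟩

@[simp] theorem loop_zero (i : Fin g) : C.loop i 0 = C.ptV i := by
  have := C.loop_coe i (left_mem_Icc.2 (C.length_pos i).le)
  rwa [cyclePt_zero] at this

@[simp] theorem loop_posW (i : Fin g) : C.loop i (C.posW i) = C.ptW i := by
  have := C.loop_coe i (t := C.vw i)
    ⟨(C.vw_pos i).le, by have := C.wv_pos i; rw [length]; linarith⟩
  rwa [cyclePt_vw] at this

theorem retract_loop_self (i : Fin g) (x : AddCircle (C.length i)) :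
    C.retract i (C.loop i x) = x := by
  obtain ⟨t, ht, rfl⟩ := C.exists_coe_eq i x
  rw [C.loop_coe i ht, C.retract_cyclePt i i ht, if_pos rfl]

theorem retract_loop_of_ne {i j : Fin g} (h : j ≠ i) (x : AddCircle (C.length j)) :
    C.retract i (C.loop j x) = if i < j then C.posW i else 0 := by
  obtain ⟨t, ht, rfl⟩ := C.exists_coe_eq j x
  rw [C.loop_coe j ht, C.retract_cyclePt i j ht, if_neg h]

/-- Real lifts of the four positions have signed sum in `ℤ • length i`; this multiple is the slope
`σ` that `isPrincipal_cycle` asks for. -/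
theorem isPrincipal_loop_add (i : Fin g) (x y : AddCircle (C.length i)) :
    C.graph.IsPrincipal (Finsupp.single (C.loop i x) 1 + Finsupp.single (C.loop i y) 1 -
      Finsupp.single (C.loop i (x + y)) 1 - Finsupp.single (C.ptV i) 1) := by
  obtain ⟨s, hs, rfl⟩ := C.exists_coe_eq i x
  obtain ⟨t, ht, rfl⟩ := C.exists_coe_eq i y
  obtain ⟨u, hu, hst⟩ := C.exists_coe_eq i ((s : AddCircle (C.length i)) + t)
  rw [← hst, C.loop_coe i hs, C.loop_coe i ht, C.loop_coe i hu, ← C.cyclePt_zero]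
  rw [← AddCircle.coe_add, eq_comm, ← sub_eq_zero, ← AddCircle.coe_sub,
    AddCircle.coe_eq_zero_iff] at hst
  obtain ⟨σ, hσ⟩ := hst
  rw [zsmul_eq_mul] at hσ
  have := C.isPrincipal_cycle i (Finsupp.single s 1 + Finsupp.single t 1 + Finsupp.single u (-1) +
    Finsupp.single 0 (-1)) ?_ ?_ σ ?_
  · simp only [Finsupp.mapDomain_add, Finsupp.mapDomain_single] at this
    simpa [sub_eq_add_neg] using this
  · classical
    intro v hv
    have h0 := left_mem_Icc.2 (C.length_pos i).le
    rcases Finset.mem_union.1 (Finsupp.support_add hv) with hv | hv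
    · rcases Finset.mem_union.1 (Finsupp.support_add hv) with hv | hv
      · rcases Finset.mem_union.1 (Finsupp.support_add hv) with hv | hv
        · rwa [Finset.mem_singleton.1 (Finsupp.support_single_subset hv)]
        · rwa [Finset.mem_singleton.1 (Finsupp.support_single_subset hv)]
      · rwa [Finset.mem_singleton.1 (Finsupp.support_single_subset hv)]
    · rwa [Finset.mem_singleton.1 (Finsupp.support_single_subset hv)]
  · rw [sum_single_add, sum_single_add, sum_single_add, Finsupp.sum_single_index rfl]
    norm_num
  · simp only [sum_mul_single_add _ (fun u => u)]
    simp
    linarith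

/-- The class of `p - v i`, for a point `p` of the `i`-th cycle, depends additively on `p`. -/
def cycleClass (i : Fin g) : AddCircle (C.length i) →+ C.graph.Pic :=
  AddMonoidHom.mk' (fun x => C.graph.cls (Finsupp.single (C.loop i x) 1) -
    C.graph.cls (Finsupp.single (C.ptV i) 1)) fun x y => by
    have := cls_eq_zero_iff.2 (C.isPrincipal_loop_add i x y)
    rw [map_sub, map_sub, map_add] at this
    rw [← sub_eq_zero, ← neg_eq_zero, ← this]
    abel

theorem cls_loop (i : Fin g) (x : AddCircle (C.length i)) :
    C.graph.cls (Finsupp.single (C.loop i x) 1) =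
      C.graph.cls (Finsupp.single (C.ptV i) 1) + C.cycleClass i x := by
  simp [cycleClass]

theorem cls_edgeBridge (i : Fin (g - 1)) {t : ℝ} (ht : t ∈ Icc 0 (C.bridge i)) :
    C.graph.cls (Finsupp.single (C.graph.pt (C.edgeBridge i) t) 1) =
      C.graph.cls (Finsupp.single (C.ptW ⟨i, by omega⟩) 1) := by
  have := cls_eq_zero_iff.2 (C.isPrincipal_bridge i ht)
  rw [map_sub, sub_eq_zero, pt_zero] at this
  exact this

theorem cls_ptV_succ (i : ℕ) (hi : i + 1 < g) :
    C.graph.cls (Finsupp.single (C.ptV ⟨i + 1, hi⟩) 1) =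
      C.graph.cls (Finsupp.single (C.ptW ⟨i, by omega⟩) 1) := by
  have := C.cls_edgeBridge ⟨i, by omega⟩ (right_mem_Icc.2 (C.bridge_nonneg ⟨i, by omega⟩))
  rw [← this]
  have h := pt_len (C.edgeBridge ⟨i, by omega⟩)
  change C.graph.pt _ (C.bridge _) = C.ptV _ at h
  rw [h]

theorem point_cases (p : C.graph.Point) : (∃ i x, p = C.loop i x) ∨
    ∃ i : Fin (g - 1), ∃ t ∈ Icc 0 (C.bridge i), p = C.graph.pt (C.edgeBridge i) t := by
  have hl (i : Fin g) : C.length i = C.vw i + C.wv i := rfl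
  obtain ⟨(i | i) | ⟨(i | i) | i, t, ht⟩⟩ := p
  · exact .inl ⟨i, 0, (C.loop_zero i).symm⟩
  · exact .inl ⟨i, C.posW i, (C.loop_posW i).symm⟩
  · change t ∈ Icc 0 (C.vw i) at ht
    refine .inl ⟨i, t, ?_⟩
    rw [C.loop_coe i ⟨ht.1, by linarith [ht.2, C.wv_pos i, hl i]⟩, cyclePt, if_pos ht.2]
    exact (pt_of_mem (C.edgeVW i) ht).symm
  · change t ∈ Icc 0 (C.wv i) at ht
    refine .inl ⟨i, (C.vw i + t : ℝ), ?_⟩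
    rw [C.loop_coe i ⟨by linarith [ht.1, C.vw_pos i], by linarith [ht.2, hl i]⟩, cyclePt]
    split_ifs with h
    · have h0 : t = 0 := by linarith [ht.1]
      subst h0
      rw [add_zero, pt_edgeVW_len, ← pt_edgeWV_zero]
      exact (pt_of_mem (C.edgeWV i) ht).symm
    · rw [add_sub_cancel_left]
      exact (pt_of_mem (C.edgeWV i) ht).symm
  · exact .inr ⟨i, t, ht, (pt_of_mem (C.edgeBridge i) ht).symm⟩

/-- Moving a point along the `i`-th cycle changes no retraction except the `i`-th, so a formula
valid at `v i` spreads over the cycle. -/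
theorem cls_single_loop_eq (i : Fin g) (P : C.graph.Pic)
    (h : C.graph.cls (Finsupp.single (C.ptV i) 1) =
      P + ∑ j, C.cycleClass j (C.retract j (C.ptV i))) (x : AddCircle (C.length i)) :
    C.graph.cls (Finsupp.single (C.loop i x) 1) =
      P + ∑ j, C.cycleClass j (C.retract j (C.loop i x)) := by
  have : ∑ j, C.cycleClass j (C.retract j (C.loop i x)) -
      ∑ j, C.cycleClass j (C.retract j (C.ptV i)) = C.cycleClass i x := by
    rw [← Finset.sum_sub_distrib, Finset.sum_eq_single i]
    · rw [retract_loop_self, retract_ptV, if_neg (lt_irrefl i), map_zero, sub_zero]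
    · intro j _ hj
      rw [C.retract_loop_of_ne hj.symm, retract_ptV, sub_self]
    · simp
  rw [cls_loop, h, ← this]
  abel

/-- Walk from the first vertex to `p`: each traversed cycle contributes the class of `w j - v j`,
bridges contribute nothing, and the cycles behind `p` have retraction `0`. -/
theorem cls_single_eq (hg : 0 < g) (p : C.graph.Point) : C.graph.cls (Finsupp.single p 1) =
    C.graph.cls (Finsupp.single (C.ptV ⟨0, hg⟩) 1) + ∑ j, C.cycleClass j (C.retract j p) := by
  have hV : ∀ i (hi : i < g), C.graph.cls (Finsupp.single (C.ptV ⟨i, hi⟩) 1) =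
      C.graph.cls (Finsupp.single (C.ptV ⟨0, hg⟩) 1) +
        ∑ j, C.cycleClass j (C.retract j (C.ptV ⟨i, hi⟩)) := by
    intro i
    induction i with
    | zero =>
      intro hi
      rw [Finset.sum_eq_zero, add_zero]
      intro j _
      rw [retract_ptV, if_neg (by simp [Fin.lt_def]), map_zero]
    | succ i ih =>
      intro hi
      rw [cls_ptV_succ, ← loop_posW, C.cls_single_loop_eq _ _ (ih (by omega))]
      congr 1
      refine Finset.sum_congr rfl fun j _ => ?_
      rw [loop_posW, retract_ptV, retract_ptW]
      simp [Fin.lt_def, Fin.le_def]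
  rcases C.point_cases p with ⟨i, x, rfl⟩ | ⟨i, t, ht, rfl⟩
  · exact C.cls_single_loop_eq i _ (hV i i.2) x
  · rw [C.cls_edgeBridge i ht, ← loop_posW, C.cls_single_loop_eq _ _ (hV i (by omega))]
    congr 1
    refine Finset.sum_congr rfl fun j _ => ?_
    rw [loop_posW, C.retract_pt j (C.edgeBridge i) ht, retract_ptW, edgeRetract_edgeBridge]
    rfl

theorem cls_eq (hg : 0 < g) (D : C.graph.Div) : C.graph.cls D =
    C.graph.deg D • C.graph.cls (Finsupp.single (C.ptV ⟨0, hg⟩) 1) +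
      ∑ j, C.cycleClass j (C.coord j D) := by
  induction D using Finsupp.induction_linear with
  | zero => simp
  | add D E hD hE =>
    simp only [map_add, Finset.sum_add_distrib]
    rw [hD, hE, add_zsmul]
    abel
  | single p k =>
    have : (Finsupp.single p k : C.graph.Div) = k • Finsupp.single p 1 := by simp
    rw [this]
    simp only [map_zsmul, deg_single, ← Finset.smul_sum, smul_assoc, one_smul]
    rw [C.cls_single_eq hg p]
    rw [zsmul_add]
    simp [coord]

/-- The coordinates of a divisor class. -/
def picCoord (i : Fin g) : C.graph.Pic →+ AddCircle (C.length i) :=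
  QuotientAddGroup.lift C.graph.Prin (C.coord i) fun _ hD => C.coord_eq_zero_of_isPrincipal hD i

@[simp] theorem picCoord_cls (i : Fin g) (D : C.graph.Div) :
    C.picCoord i (C.graph.cls D) = C.coord i D := rfl

/-- A divisor class is determined by its degree and its coordinates. -/
theorem pic_ext (hg : 0 < g) {c c' : C.graph.Pic} (hdeg : C.graph.degPic c = C.graph.degPic c')
    (h : ∀ i, C.picCoord i c = C.picCoord i c') : c = c' := by
  obtain ⟨D, rfl⟩ := QuotientAddGroup.mk'_surjective _ c
  obtain ⟨D', rfl⟩ := QuotientAddGroup.mk'_surjective _ c'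
  change C.graph.cls D = C.graph.cls D'
  rw [C.cls_eq hg D, C.cls_eq hg D']
  congr 1
  · exact congrArg (· • _) hdeg
  · exact Finset.sum_congr rfl fun j _ => congrArg _ (h j)

end ChainOfCycles

/-! ### Growing regions of boxes and tableaux. -/

/-- The region that grows from the complement of the positive quadrant by adding, at the `k`-th
step, all addable boxes on the diagonals selected by `M k`. -/
def growth (M : ℕ → ℤ → Prop) : ℕ → ℤ → ℤ → Prop
  | 0, x, y => x ≤ 0 ∨ y ≤ 0
  | k + 1, x, y => growth M k x y ∨ (M k (x - y) ∧ growth M k (x - 1) y ∧ growth M k x (y - 1))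

theorem growth_of_nonpos {M : ℕ → ℤ → Prop} (k : ℕ) {x y : ℤ} (h : x ≤ 0 ∨ y ≤ 0) :
    growth M k x y := by
  induction k with
  | zero => exact h
  | succ k ih => exact .inl ih

theorem growth.anti {M : ℕ → ℤ → Prop} {k : ℕ} {x y x' y' : ℤ} (h : growth M k x y) (hx : x' ≤ x)
    (hy : y' ≤ y) : growth M k x' y' := by
  induction k generalizing x y x' y' with
  | zero =>
    simp only [growth] at *
    omega
  | succ k ih =>
    rcases h with h | ⟨h0, h1, h2⟩
    · exact .inl (ih h hx hy)
    · rcases hx.lt_or_eq with hx' | rfl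
      · exact .inl (ih h1 (by omega) hy)
      · rcases hy.lt_or_eq with hy' | rfl
        · exact .inl (ih h2 le_rfl (by omega))
        · exact .inr ⟨h0, h1, h2⟩

theorem growth.mono {M : ℕ → ℤ → Prop} {k n : ℕ} (hkn : k ≤ n) {x y : ℤ} (h : growth M k x y) :
    growth M n x y := by
  induction hkn with
  | refl => exact h
  | step _ ih => exact .inl ih

theorem growth.sub_left {M : ℕ → ℤ → Prop} {k : ℕ} {x y : ℤ} (h : growth M (k + 1) x y) :
    growth M k (x - 1) y :=
  h.elim (fun h => h.anti (by omega) le_rfl) fun h => h.2.1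

theorem growth.sub_right {M : ℕ → ℤ → Prop} {k : ℕ} {x y : ℤ} (h : growth M (k + 1) x y) :
    growth M k x (y - 1) :=
  h.elim (fun h => h.anti le_rfl (by omega)) fun h => h.2.2

/-- A Young diagram is contained in the grown region exactly when it has a tableau with strictly
increasing rows and columns each of whose symbols `k` occurs only on diagonals selected by `M k`. -/
theorem forall_growth_iff {g : ℕ} (M : ℕ → ℤ → Prop) (μ : YoungDiagram) :
    (∀ b ∈ μ.cells, growth M g (b.2 + 1) (b.1 + 1)) ↔ ∃ t : μ.cells → Fin g,
      (∀ a b : μ.cells, a.1.1 = b.1.1 → a.1.2 < b.1.2 → t a < t b) ∧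
      (∀ a b : μ.cells, a.1.2 = b.1.2 → a.1.1 < b.1.1 → t a < t b) ∧
      ∀ b, M (t b) ((b.1.2 : ℤ) - b.1.1) := by
  classical
  constructor
  · intro h
    -- The symbol of a box is the step that adds it: `k` when the box is in stage `k + 1` but not in
    -- stage `k`. Its left and lower neighbours are already in stage `k`, hence have smaller
    -- symbols.
    have key (b : μ.cells) : ∃ k : Fin g, growth M (k + 1) (b.1.2 + 1) (b.1.1 + 1) ∧
        ¬ growth M k (b.1.2 + 1) (b.1.1 + 1) := by
      have hex : ∃ n, growth M n (b.1.2 + 1) (b.1.1 + 1) := ⟨g, h b.1 b.2⟩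
      have hle : Nat.find hex ≤ g := Nat.find_min' hex (h b.1 b.2)
      have hpos : Nat.find hex ≠ 0 := fun h0 => by
        have := Nat.find_spec hex
        rw [h0] at this
        simp only [growth] at this
        omega
      refine ⟨⟨Nat.find hex - 1, by omega⟩, ?_, Nat.find_min hex (m := Nat.find hex - 1) (by omega)⟩
      simp only [Nat.sub_add_cancel (Nat.one_le_iff_ne_zero.2 hpos)]
      exact Nat.find_spec hex
    choose t ht ht' using key
    have hlt (a b : μ.cells) (hab : growth M (t b) (a.1.2 + 1) (a.1.1 + 1)) : t a < t b := by
      by_contra hle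
      exact ht' a (hab.mono (not_lt.1 hle))
    refine ⟨t, fun a b h1 h2 => hlt a b ((ht b).sub_left.anti (by omega) (by omega)),
      fun a b h1 h2 => hlt a b ((ht b).sub_right.anti (by omega) (by omega)), fun b => ?_⟩
    have := (ht b).resolve_left (ht' b)
    simpa using this.1
  · rintro ⟨t, hrow, hcol, hM⟩
    -- Conversely stage `n` contains every box with symbol below `n`: its neighbours have smaller
    -- symbols or lie outside the quadrant.
    have key : ∀ (n : ℕ) (b : μ.cells), (t b : ℕ) < n → growth M n (b.1.2 + 1) (b.1.1 + 1) := by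
      intro n
      induction n with
      | zero => intro b hb; omega
      | succ n ih =>
        intro b hb
        rcases Nat.lt_succ_iff_lt_or_eq.1 hb with hb | rfl
        · exact .inl (ih b hb)
        · refine .inr ⟨by simpa using hM b, ?_, ?_⟩
          · rcases hj : b.1.2 with _ | j
            · exact growth_of_nonpos _ (by simp)
            · have hmem : (b.1.1, j) ∈ μ.cells :=
                μ.isLowerSet (a := b.1) ⟨le_rfl, by simp [hj]⟩ b.2
              simpa using ih ⟨_, hmem⟩ (hrow ⟨_, hmem⟩ b rfl (by simp [hj]))
          · rcases hj : b.1.1 with _ | j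
            · exact growth_of_nonpos _ (by simp)
            · have hmem : (j, b.1.2) ∈ μ.cells :=
                μ.isLowerSet (a := b.1) ⟨by simp [hj], le_rfl⟩ b.2
              simpa using ih ⟨_, hmem⟩ (hcol ⟨_, hmem⟩ b rfl (by simp [hj]))
    exact fun b hb => key g ⟨b, hb⟩ (t ⟨b, hb⟩).2

/-! ### Effective divisors as chip counts. -/

namespace ChainOfCycles

open MetricGraph

variable {g : ℕ} (C : ChainOfCycles g)

/-- Each point gets a home cycle; points of a bridge belong to the cycle before it. -/
theorem exists_retract_eq (p : C.graph.Point) :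
    ∃ j : Fin g, ∀ i, i ≠ j → C.retract i p = if i < j then C.posW i else 0 := by
  rcases C.point_cases p with ⟨j, x, rfl⟩ | ⟨j, t, ht, rfl⟩
  · exact ⟨j, fun i hi => C.retract_loop_of_ne hi.symm x⟩
  · refine ⟨⟨j, by omega⟩, fun i hi => ?_⟩
    rw [C.retract_pt i (C.edgeBridge j) ht, edgeRetract_edgeBridge]
    have h1 : (i : ℕ) ≠ j := fun h => hi (Fin.ext h)
    have h2 : (i : ℕ) ≤ j ↔ i < ⟨j, by omega⟩ := by
      rw [Fin.lt_def]
      exact ⟨fun h => lt_of_le_of_ne h h1, le_of_lt⟩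
    simp only [h2]

@[simp] theorem coord_single (i : Fin g) (p : C.graph.Point) (k : ℤ) :
    C.coord i (Finsupp.single p k) = k • C.retract i p := divLift_single _ _ _

/-- `S k` is the number of points on the cycles from the `k`-th one on of an effective divisor
whose coordinates are `x i` for `k ≤ i`. -/
def IsChipSeq (k : ℕ) (x : ∀ i, AddCircle (C.length i)) (S : ℕ → ℤ) : Prop :=
  S g = 0 ∧ ∀ i : Fin g, k ≤ i →
    S (i + 1) ≤ S i ∧ (S i = S (i + 1) → x i = S (i + 1) • C.posW i)

variable {C}

theorem IsChipSeq.update {k : ℕ} {x : ∀ i, AddCircle (C.length i)} {S : ℕ → ℤ} (hk : k < g)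
    (h : C.IsChipSeq (k + 1) x S) {v : ℤ} (hv : S (k + 1) ≤ v)
    (hx : v = S (k + 1) → x ⟨k, hk⟩ = S (k + 1) • C.posW ⟨k, hk⟩) :
    C.IsChipSeq k x (Function.update S k v) := by
  refine ⟨by rw [Function.update_of_ne hk.ne']; exact h.1, fun i hi => ?_⟩
  rw [Function.update_of_ne (show (i : ℕ) + 1 ≠ k by omega)]
  rcases hi.eq_or_lt with h1 | h1
  · obtain rfl : i = ⟨k, hk⟩ := Fin.ext h1.symm
    rw [Function.update_self]
    exact ⟨hv, hx⟩
  · rw [Function.update_of_ne h1.ne']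
    exact h.2 i h1

theorem IsChipSeq.congr {k : ℕ} {x x' : ∀ i, AddCircle (C.length i)} {S : ℕ → ℤ}
    (h : C.IsChipSeq k x S) (hx : ∀ i : Fin g, k ≤ i → x' i = x i) : C.IsChipSeq k x' S :=
  ⟨h.1, fun i hi => ⟨(h.2 i hi).1, fun h' => (hx i hi).trans ((h.2 i hi).2 h')⟩⟩

theorem IsChipSeq.mono {k n : ℕ} (hkn : k ≤ n) {x : ∀ i, AddCircle (C.length i)} {S : ℕ → ℤ}
    (h : C.IsChipSeq k x S) : C.IsChipSeq n x S :=
  ⟨h.1, fun i hi => h.2 i (hkn.trans hi)⟩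

/-- A point can be added on the first cycle. -/
theorem IsChipSeq.exists_eq (hg : 0 < g) {x : ∀ i, AddCircle (C.length i)} {S : ℕ → ℤ}
    (h : C.IsChipSeq 0 x S) {d : ℤ} (hd : S 0 ≤ d) : ∃ S', C.IsChipSeq 0 x S' ∧ S' 0 = d := by
  have h0 := h.2 ⟨0, hg⟩ le_rfl
  exact ⟨_, (h.mono zero_le_one).update hg (h0.1.trans hd)
    fun hh => h0.2 (le_antisymm (hd.trans hh.le) h0.1), Function.update_self ..⟩

/-- Every chip sequence is realized by an effective divisor, built from the last cycle backwards. -/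
theorem IsChipSeq.exists_div {x : ∀ i, AddCircle (C.length i)} {S : ℕ → ℤ}
    (h : C.IsChipSeq 0 x S) {k : ℕ} (hk : k ≤ g) : ∃ E : C.graph.Div, 0 ≤ E ∧
      C.graph.deg E = S k ∧ ∀ i : Fin g, C.coord i E = if k ≤ i then x i else S k • C.posW i := by
  refine Nat.decreasingInduction (motive := fun k _ => ∃ E : C.graph.Div, 0 ≤ E ∧
    C.graph.deg E = S k ∧ ∀ i : Fin g, C.coord i E = if k ≤ i then x i else S k • C.posW i)
    (fun k hk ih => ?_) ⟨0, le_rfl, by simp [h.1], fun i => by simp [h.1]⟩ hk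
  obtain ⟨E, hE, hdeg, hcoord⟩ := ih
  have hk' := h.2 ⟨k, hk⟩ (Nat.zero_le _)
  have hcases (i : Fin g) (hi : i ≠ ⟨k, hk⟩) : (k + 1 ≤ (i : ℕ) ↔ k ≤ i) ∧
      (i < ⟨k, hk⟩ ↔ ¬ k ≤ i) := by
    have : (i : ℕ) ≠ k := fun hh => hi (Fin.ext hh)
    exact ⟨by omega, not_le.symm⟩
  rcases hk'.1.lt_or_eq with hlt | heq
  · simp only at hlt
    -- All new chips but one sit at `v k`, where they do not affect the `k`-th coordinate; the last
    -- one corrects this coordinate. Earlier cycles see all of them at their `w`.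
    refine ⟨E + Finsupp.single (C.ptV ⟨k, hk⟩) (S k - S (k + 1) - 1) +
      Finsupp.single (C.loop ⟨k, hk⟩ (x ⟨k, hk⟩ - S (k + 1) • C.posW ⟨k, hk⟩)) 1,
      add_nonneg (add_nonneg hE (Finsupp.single_nonneg.2 (by omega)))
        (Finsupp.single_nonneg.2 zero_le_one), by simp only [map_add, hdeg, deg_single]; ring, fun i => ?_⟩
    simp only [map_add, hcoord, coord_single, retract_ptV, one_smul]
    by_cases hi : i = ⟨k, hk⟩
    · subst hi
      rw [retract_loop_self]
      simp
    · rw [C.retract_loop_of_ne (Ne.symm hi)]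
      simp only [hcases i hi]
      by_cases hki : k ≤ i
      · simp [hki]
      · simp only [hki, if_false, not_false_iff, if_true]
        have : S k = S (k + 1) + (S k - S (k + 1) - 1) + 1 := by ring
        conv_rhs => rw [this, add_smul, add_smul, one_smul]
  · simp only at heq
    refine ⟨E, hE, hdeg.trans heq, fun i => ?_⟩
    rw [hcoord]
    by_cases hi : i = ⟨k, hk⟩
    · subst hi
      rw [hk'.2 heq.symm]
      simp
    · simp only [hcases i hi, heq]

theorem exists_isChipSeq {E : C.graph.Div} (hE : 0 ≤ E) :
    ∃ S, C.IsChipSeq 0 (fun i => C.coord i E) S ∧ S 0 = C.graph.deg E := by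
  classical
  choose j hj using C.exists_retract_eq
  have hsum {G : Type} [AddCommGroup G] (ρ : C.graph.Point → G) :
      divLift ρ E = ∑ p ∈ E.support, E p • ρ p := by
    nth_rw 1 [← Finsupp.sum_single E]
    rw [Finsupp.sum, map_sum]
    simp
  -- The count, with multiplicity, of the points of `E` whose home cycle is at least `k`.
  refine ⟨fun k => divLift (fun p => if k ≤ j p then (1 : ℤ) else 0) E,
    ⟨(hsum _).trans (Finset.sum_eq_zero fun p _ => by
      rw [if_neg (not_le.2 (j p).2), smul_zero]), fun i _ => ?_⟩, ?_⟩
  · have hsub : divLift (fun p => if (i : ℕ) ≤ j p then (1 : ℤ) else 0) E =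
        divLift (fun p => if (i : ℕ) + 1 ≤ j p then (1 : ℤ) else 0) E +
          ∑ p ∈ E.support, if j p = i then E p else 0 := by
      simp only [hsum, ← Finset.sum_add_distrib]
      refine Finset.sum_congr rfl fun p _ => ?_
      have : (j p = i) ↔ (j p : ℕ) = i := Fin.ext_iff
      simp only [this, smul_eq_mul, mul_ite, mul_one, mul_zero]
      split_ifs <;> omega
    have hnn : ∀ p ∈ E.support, 0 ≤ if j p = i then E p else 0 := fun p _ => by
      split_ifs
      exacts [hE p, le_rfl]
    refine ⟨?_, fun h => ?_⟩
    · simp only [hsub]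
      linarith [Finset.sum_nonneg hnn]
    · simp only [hsub, add_eq_left] at h
      rw [Finset.sum_eq_zero_iff_of_nonneg hnn] at h
      have : ∀ p ∈ E.support, i ≠ j p := fun p hp hi => by
        have h' := h p hp
        rw [if_pos hi.symm] at h'
        exact Finsupp.mem_support_iff.1 hp h'
      simp only [coord, hsum, Finset.sum_smul]
      refine Finset.sum_congr rfl fun p hp => ?_
      rw [hj p i (this p hp), smul_assoc]
      have : (i : ℕ) + 1 ≤ j p ↔ i < j p := Iff.rfl
      simp only [this]
      split_ifs <;> simp
  · simp only [Nat.zero_le, if_true]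
    rw [hsum]
    simp only [smul_eq_mul, mul_one]
    rfl

/-! ### The rank as a game on boxes. -/

variable (C)

theorem isEffective_iff (hg : 0 < g) (c : C.graph.Pic) : IsEffective c ↔
    ∃ S, C.IsChipSeq 0 (fun i => C.picCoord i c) S ∧ S 0 = C.graph.degPic c := by
  constructor
  · rintro ⟨E, hE, rfl⟩
    exact exists_isChipSeq hE
  · rintro ⟨S, hS, hd⟩
    obtain ⟨E, hE, hdeg, hcoord⟩ := hS.exists_div (Nat.zero_le g)
    exact ⟨E, hE, C.pic_ext hg (hdeg.trans hd) fun i => by simp [hcoord]⟩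

theorem le_rank_iff_isChipSeq (hg : 0 < g) (c : C.graph.Pic) (r : ℤ) :
    r ≤ rank c ↔ ∀ e T, C.IsChipSeq 0 e T → T 0 = r →
      ∃ S, C.IsChipSeq 0 (fun i => C.picCoord i c - e i) S ∧ S 0 = C.graph.degPic c - r := by
  have : Nonempty C.graph.Point := ⟨C.ptV ⟨0, hg⟩⟩
  rw [le_rank_iff]
  constructor
  · intro h e T hT hr
    obtain ⟨E, hE, hdeg, hcoord⟩ := hT.exists_div (Nat.zero_le g)
    have := (C.isEffective_iff hg _).1 (h E hE (hdeg.trans hr))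
    simpa [hcoord, degPic_cls, hdeg, hr] using this
  · intro h E hE hr
    obtain ⟨T, hT, hT0⟩ := exists_isChipSeq hE
    rw [isEffective_iff C hg]
    simpa [degPic_cls, hr] using h _ T hT (hT0.trans hr)

/-- This is where `v i ≠ w i` enters: it allows the adversary to spoil a coincidence of coordinates.
-/
theorem posW_ne_zero (i : Fin g) : C.posW i ≠ 0 := by
  intro h
  rw [posW, AddCircle.coe_eq_zero_iff_of_mem_Ico
    ⟨(C.vw_pos i).le, by have := C.wv_pos i; rw [length]; linarith⟩] at h
  exact (C.vw_pos i).ne' h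

/-- The rank of a divisor class in terms of growing Young diagrams. -/
theorem le_rank_iff_growth (hg : 0 < g) (c : C.graph.Pic) {r : ℤ} (hr : 0 ≤ r) (M : ℕ → ℤ → Prop)
    (hM : ∀ (i : Fin g) (z : ℤ),
      M i z ↔ C.picCoord i c = (z - i + C.graph.degPic c) • C.posW i) :
    r ≤ rank c ↔ growth M g (g - C.graph.degPic c + r) (r + 1) := by
  set d := C.graph.degPic c with hd
  rw [C.le_rank_iff_isChipSeq hg]
  constructor
  · contrapose!
    intro hG
    -- The adversary builds the divisor to subtract, as `e` and `T`, where `U` bounds from below the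
    -- chips any effective remainder has on the cycles from `k` on. The box `(U + k + r - d, r + 1 -
    -- T k)` is kept outside stage `k`. At `k = 0` both its entries are positive, so `U > d - r` and
    -- no remainder of degree `d - r` is effective.
    have key := Nat.decreasingInduction (n := g) (motive := fun k _ => ∃ e T, ∃ U : ℤ,
      C.IsChipSeq k e T ∧ T k ≤ r ∧ ¬ growth M k (U + k + r - d) (r + 1 - T k) ∧
        ∀ S, C.IsChipSeq k (fun i => C.picCoord i c - e i) S → U ≤ S k)
      (fun k hk ih => ?_) ⟨0, 0, 0, ⟨rfl, fun i hi => absurd i.2 (by omega)⟩, hr, ?_, fun S hS => ?_⟩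
      (Nat.zero_le g)
    · obtain ⟨e, T, U, hT, hTr, hU, hS⟩ := key
      simp only [growth, not_or, not_le] at hU
      obtain ⟨T', hT', hT0⟩ := hT.exists_eq hg hTr
      refine ⟨e, T', hT', hT0, fun S hS' hS0 => ?_⟩
      have := hS S hS'
      push_cast at hU
      omega
    · obtain ⟨e, T, U, hT, hTr, hU, hS⟩ := ih
      set i : Fin g := ⟨k, hk⟩ with hi
      have hne (v : AddCircle (C.length i)) (j : Fin g) (hj : k + 1 ≤ j) :
          Function.update e i v j = e j :=
        Function.update_of_ne (fun hh => by rw [hh, hi] at hj; simp at hj) _ _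
      have hT' (v : AddCircle (C.length i)) : C.IsChipSeq (k + 1) (Function.update e i v) T :=
        hT.congr (hne v)
      have hS' (v : AddCircle (C.length i)) (S : ℕ → ℤ) (h : C.IsChipSeq k
          (fun j => C.picCoord j c - Function.update e i v j) S) : U ≤ S (k + 1) ∧ S (k + 1) ≤ S k ∧
          (S k = S (k + 1) → C.picCoord i c - v = S (k + 1) • C.posW i) := by
        refine ⟨hS S ((h.mono (Nat.le_succ k)).congr fun j hj => by rw [hne v j hj]), ?_⟩
        have := h.2 i le_rfl
        simpa using this
      by_cases hTU : M k (U + (k + 1 : ℕ) + r - d - (r + 1 - T (k + 1)))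
      · by_cases hR : growth M k (U + (k + 1 : ℕ) + r - d) (r + 1 - T (k + 1) - 1)
        · have hL : ¬ growth M k (U + (k + 1 : ℕ) + r - d - 1) (r + 1 - T (k + 1)) := fun hL =>
            hU (.inr ⟨hTU, hL, hR⟩)
          -- The left neighbour is missing: subtracting no chip here leaves `U` unchanged and moves
          -- to that neighbour.
          refine ⟨_, _, U, (hT' (T (k + 1) • C.posW i)).update hk le_rfl fun _ =>
            Function.update_self ..,
            by simpa, ?_, fun S h => ?_⟩
          · rw [Function.update_self]
            convert hL using 2
            push_cast
            ring
          · have := hS' _ S h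
            omega
        · have hT1 : T (k + 1) + 1 ≤ r := by
            by_contra hlt
            exact hR (growth_of_nonpos _ (.inr (by omega)))
          -- The lower neighbour is missing: one chip is subtracted here, placed so that the
          -- remaining coordinate is `(U + 1) • posW i`. It differs from `U • posW i`, so a
          -- remainder with `U` chips behind needs another one here.
          refine ⟨_, _, U + 1, (hT' (C.picCoord i c - U • C.posW i - C.posW i)).update hk
            (v := T (k + 1) + 1) (by omega) fun h => by omega, by simpa, ?_, fun S h => ?_⟩
          · rw [Function.update_self]
            convert hR using 2
            · push_cast
              ring
            · ring
          · obtain ⟨h1, h2, h3⟩ := hS' _ S h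
            by_contra hlt
            have e1 : S (k + 1) = U := by omega
            have := h3 (by omega)
            rw [e1] at this
            apply C.posW_ne_zero i
            rw [← sub_eq_zero] at this
            rw [← this]
            abel
      -- On an unselected diagonal no chip need be subtracted: a remainder with only `U` chips would
      -- force the coincidence that `M k` denies. The box stays where it is.
      · refine ⟨_, _, U + 1, (hT' (T (k + 1) • C.posW i)).update hk le_rfl fun _ =>
            Function.update_self ..,
          by simpa, ?_, fun S h => ?_⟩
        · rw [Function.update_self]
          intro hG
          apply hU
          left
          convert hG using 1
          push_cast
          ring
        · obtain ⟨h1, h2, h3⟩ := hS' _ S h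
          by_contra hlt
          have e1 : S (k + 1) = U := by omega
          have := h3 (by omega)
          apply hTU
          rw [show k = ((i : Fin g) : ℕ) from rfl, hM i, eq_add_of_sub_eq this, e1, ← add_smul]
          congr 1
          push_cast
          ring
    · convert hG using 2
      · simp
        ring
      · simp
    · rw [hS.1]
  · intro hG e T hT hTr
    -- The defender answers a given `T`, keeping the box inside stage `k`: `S` stays unchanged only
    -- if `T` does and the diagonal is selected, and otherwise grows by one. At `k = 0` the entry `r
    -- + 1 - T 0 = 1` is positive, so `S 0 ≤ d - r`.
    have key := Nat.decreasingInduction (n := g) (motive := fun k _ => ∃ S,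
      C.IsChipSeq k (fun i => C.picCoord i c - e i) S ∧
        growth M k (S k + k + r - d) (r + 1 - T k))
      (fun k hk ih => ?_) ⟨0, ⟨rfl, fun i hi => absurd i.2 (by omega)⟩, ?_⟩ (Nat.zero_le g)
    · obtain ⟨S, hS, hSg⟩ := key
      simp only [growth] at hSg
      push_cast at hSg
      exact hS.exists_eq hg (by omega)
    · obtain ⟨S, hS, hSg⟩ := ih
      set i : Fin g := ⟨k, hk⟩ with hi
      obtain ⟨hT1, hT2⟩ := hT.2 i (Nat.zero_le _)
      change T (k + 1) ≤ T k at hT1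
      change T k = T (k + 1) → e i = T (k + 1) • C.posW i at hT2
      rcases hT1.lt_or_eq with hlt | heq
      · refine ⟨_, hS.update hk (v := S (k + 1) + 1) (by omega) fun h => by omega, ?_⟩
        rw [Function.update_self]
        exact hSg.sub_right.anti (by push_cast; omega) (by omega)
      · by_cases hTU : M k (S (k + 1) + (k + 1 : ℕ) + r - d - (r + 1 - T (k + 1)))
        · refine ⟨_, hS.update hk le_rfl fun _ => ?_, ?_⟩
          · change C.picCoord i c - e i = _
            rw [hT2 heq.symm, (hM i _).1 hTU, ← sub_smul]
            congr 1
            simp only [hi]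
            push_cast
            ring
          · rw [Function.update_self]
            exact hSg.sub_left.anti (by push_cast; omega) (by omega)
        · refine ⟨_, hS.update hk (v := S (k + 1) + 1) (by omega) fun h => by omega, ?_⟩
          rw [Function.update_self]
          exact (hSg.resolve_right fun h => hTU h.1).anti (by push_cast; omega) (by omega)
    · convert hG using 1
      · simp
        ring
      · simp [hT.1]

end ChainOfCycles

/-! ### Coordinate subspaces and products of local homeomorphisms. -/

/-- An affine coordinate subspace has the expected Hausdorff dimension. -/
theorem dimH_setOf_forall_mem_eq {ι : Type*} [Fintype ι] (R : Set ι) (β : ι → ℝ) :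
    dimH {y : ι → ℝ | ∀ i ∈ R, y i = β i} = Rᶜ.ncard := by
  classical
  let f : (↥Rᶜ → ℝ) → ι → ℝ := fun z i => if h : i ∈ R then β i else z ⟨i, h⟩
  have hf : Isometry f := by
    refine Isometry.of_dist_eq fun z z' => le_antisymm ?_ ?_
    · refine (dist_pi_le_iff dist_nonneg).2 fun i => ?_
      by_cases h : i ∈ R
      · simp only [f, h, dif_pos, dist_self, dist_nonneg]
      · simp only [f, h, dif_neg, not_false_iff]
        exact dist_le_pi_dist z z' ⟨i, h⟩
    · refine (dist_pi_le_iff dist_nonneg).2 fun i => ?_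
      have := dist_le_pi_dist (f z) (f z') i
      have hi : (i : ι) ∉ R := i.2
      simpa only [f, hi, dif_neg, not_false_iff] using this
  have hrange : {y : ι → ℝ | ∀ i ∈ R, y i = β i} = f '' univ := by
    ext y
    simp only [mem_ofPred_eq, image_univ, mem_range]
    constructor
    · intro hy
      refine ⟨fun i => y i, funext fun i => ?_⟩
      by_cases h : i ∈ R
      · simp only [f, h, dif_pos, hy i h]
      · simp only [f, h, dif_neg, not_false_iff]
    · rintro ⟨z, rfl⟩ i hi
      simp only [f, hi, dif_pos]
  rw [hrange, hf.dimH_image, Real.dimH_univ_pi, ← Nat.card_eq_fintype_card, Nat.card_coe_set_eq]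

theorem isPreconnected_setOf_forall_mem_eq {ι : Type*} [Fintype ι] (R : Set ι) (β : ι → ℝ) :
    IsPreconnected {y : ι → ℝ | ∀ i ∈ R, y i = β i} := by
  refine Convex.isPreconnected fun y hy z hz a b _ _ hab i hi => ?_
  simp only [Pi.add_apply, Pi.smul_apply, smul_eq_mul, hy i hi, hz i hi]
  rw [← add_mul, hab, one_mul]

theorem isLocalHomeomorph_piMap {ι : Type*} [Finite ι] {X Y : ι → Type*}
    [∀ i, TopologicalSpace (X i)] [∀ i, TopologicalSpace (Y i)] {f : ∀ i, X i → Y i}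
    (hf : ∀ i, IsLocalHomeomorph (f i)) : IsLocalHomeomorph fun (x : ∀ i, X i) i => f i (x i) := by
  have := Fintype.ofFinite ι
  refine IsLocalHomeomorph.mk _ fun x => ?_
  choose e he hfe using fun i => hf i (x i)
  refine ⟨OpenPartialHomeomorph.pi e, fun i _ => he i, fun y _ => funext fun i => ?_⟩
  exact congrFun (hfe i) (y i)

/-! ### The tropical Jacobian as a torus, and its universal cover. -/

namespace ChainOfCycles

open MetricGraph

variable {g : ℕ} (C : ChainOfCycles g)

/-- The coordinates of a divisor class of degree zero. -/
def pic0Coord (i : Fin g) : C.graph.Pic0 →+ AddCircle (C.length i) :=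
  (C.picCoord i).comp (Pic0.toPic C.graph)

theorem pic0_ext (hg : 0 < g) {c c' : C.graph.Pic0}
    (h : ∀ i, C.pic0Coord i c = C.pic0Coord i c') : c = c' :=
  Subtype.ext (C.pic_ext hg (c.2.trans c'.2.symm) h)

theorem pic0Coord_diffClass (i : Fin g) (n : ℕ)
    (x : (Fin n → C.graph.Point) × (Fin n → C.graph.Point)) :
    C.pic0Coord i (C.graph.diffClass n x) =
      ∑ j, (C.retract i (x.1 j) - C.retract i (x.2 j)) := by
  change C.coord i _ = _
  simp [map_sum, map_sub]

theorem continuous_pic0Coord (i : Fin g) : Continuous (C.pic0Coord i) := by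
  refine continuous_iSup_dom.2 fun n => continuous_coinduced_dom.2 ?_
  have : C.pic0Coord i ∘ C.graph.diffClass n =
      fun x => ∑ j, (C.retract i (x.1 j) - C.retract i (x.2 j)) :=
    funext (C.pic0Coord_diffClass i n)
  rw [this]
  have := C.continuous_retract i
  fun_prop

/-- The class with given coordinates. -/
def ofCoord (x : ∀ i, AddCircle (C.length i)) : C.graph.Pic0 :=
  C.graph.diffClass g (fun i => C.loop i (x i), C.ptV)

theorem continuous_ofCoord : Continuous C.ofCoord := by
  have h : Continuous (C.graph.diffClass g) :=
    continuous_iSup_rng (i := g) continuous_coinduced_rng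
  refine h.comp (Continuous.prodMk (continuous_pi fun i => ?_) continuous_const)
  exact (C.continuous_loop i).comp (continuous_apply i)

@[simp] theorem pic0Coord_ofCoord (i : Fin g) (x : ∀ i, AddCircle (C.length i)) :
    C.pic0Coord i (C.ofCoord x) = x i := by
  rw [ofCoord, pic0Coord_diffClass, Finset.sum_eq_single i]
  · rw [retract_loop_self, retract_ptV, if_neg (lt_irrefl i), sub_zero]
  · intro j _ hj
    rw [C.retract_loop_of_ne hj, retract_ptV, sub_self]
  · simp

/-- The tropical Jacobian is a product of circles. -/
def pic0Homeomorph (hg : 0 < g) : (∀ i, AddCircle (C.length i)) ≃ₜ C.graph.Pic0 where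
  toFun := C.ofCoord
  invFun := fun c i => C.pic0Coord i c
  left_inv x := funext fun i => C.pic0Coord_ofCoord i x
  right_inv _ := C.pic0_ext hg fun i => C.pic0Coord_ofCoord i _
  continuous_toFun := C.continuous_ofCoord
  continuous_invFun := continuous_pi C.continuous_pic0Coord

/-- The universal covering of the tropical Jacobian. -/
def cover (hg : 0 < g) : (Fin g → ℝ) →+ C.graph.Pic0 :=
  AddMonoidHom.mk' (fun y => C.ofCoord fun i => (y i : AddCircle (C.length i))) fun y z =>
    C.pic0_ext hg fun i => by simp

@[simp] theorem pic0Coord_cover (hg : 0 < g) (y : Fin g → ℝ) (i : Fin g) :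
    C.pic0Coord i (C.cover hg y) = (y i : AddCircle (C.length i)) :=
  C.pic0Coord_ofCoord i _

theorem isLocalHomeomorph_cover (hg : 0 < g) : IsLocalHomeomorph (C.cover hg) :=
  (C.pic0Homeomorph hg).isLocalHomeomorph.comp (g := C.pic0Homeomorph hg)
    (isLocalHomeomorph_piMap fun i => AddCircle.isLocalHomeomorph_coe (C.length i))

theorem cover_surjective (hg : 0 < g) : Function.Surjective (C.cover hg) := by
  intro c
  choose y _ hy using fun i => C.exists_coe_eq i (C.pic0Coord i c)
  exact ⟨y, C.pic0_ext hg fun i => by rw [pic0Coord_cover, hy]⟩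

theorem genus_graph (hg : 0 < g) : C.graph.genus = g := by
  have h1 : Nat.card C.graph.E = Nat.card ((Fin g ⊕ Fin g) ⊕ Fin (g - 1)) := rfl
  have h2 : Nat.card C.graph.V = Nat.card (Fin g ⊕ Fin g) := rfl
  rw [genus, h1, h2]
  simp only [Nat.card_eq_fintype_card, Fintype.card_sum, Fintype.card_fin]
  omega

/-- The conventions for infinite order agree: `sInf ∅ = 0` on one side, `addOrderOf = 0` on the
other. -/
theorem torsion_eq_addOrderOf (i : Fin g) : C.torsion i = addOrderOf (C.posW i) := by
  have h (m : ℕ) : (∃ k : ℤ, (m : ℝ) * C.vw i = k * (C.vw i + C.wv i)) ↔ m • C.posW i = 0 := by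
    rw [posW, ← AddCircle.coe_nsmul, AddCircle.coe_eq_zero_iff]
    simp only [nsmul_eq_mul, zsmul_eq_mul, eq_comm, length]
  rw [torsion]
  simp only [h]
  rcases Nat.eq_zero_or_pos (addOrderOf (C.posW i)) with h0 | hpos
  · rw [h0, Nat.sInf_eq_zero]
    right
    rw [eq_empty_iff_forall_notMem]
    rintro m ⟨hm, hm'⟩
    have := Nat.eq_zero_of_zero_dvd (h0 ▸ addOrderOf_dvd_of_nsmul_eq_zero hm')
    omega
  · refine le_antisymm (Nat.sInf_le ⟨hpos, addOrderOf_nsmul_eq_zero _⟩) ?_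
    exact le_csInf ⟨_, hpos, addOrderOf_nsmul_eq_zero _⟩
      fun m hm => addOrderOf_le_of_nsmul_eq_zero hm.1 hm.2

theorem zsmul_posW_eq_iff (i : Fin g) (m n : ℤ) :
    m • C.posW i = n • C.posW i ↔ m ≡ n [ZMOD C.torsion i] := by
  rw [torsion_eq_addOrderOf, Int.modEq_comm, Int.modEq_iff_dvd, addOrderOf_dvd_iff_zsmul_eq_zero,
    sub_smul, sub_eq_zero]

theorem coord_lastPoint (hg : 0 < g) (i : Fin g) :
    C.picCoord i (C.graph.cls (Finsupp.single (C.lastPoint hg) 1)) = C.posW i := by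
  have h : C.retract i (C.lastPoint hg) = C.posW i :=
    (C.retract_ptW i ⟨g - 1, by omega⟩).trans (if_pos (by rw [Fin.le_def]; simp only; omega))
  rw [picCoord_cls, coord_single, h, one_smul]

/-! ### The Brill-Noether locus as a union of tori. -/

/-- The torus of the divisor classes whose coordinates are prescribed by the tableau `t`. -/
def tableauTorus {μ : YoungDiagram} (t : μ.cells → Fin g) : Set C.graph.Pic0 :=
  {c | ∀ b, C.pic0Coord (t b) c = ((b.1.2 : ℤ) - b.1.1 - (t b : ℕ)) • C.posW (t b)}

/-- Adding `d` times the marked point shifts each coordinate by `d • posW`, which cancels the degree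
in the condition of `le_rank_iff_growth`. Hence a single growth process, independent of `d` and `r`,
serves all boxes. -/
theorem mem_brillNoetherLocus_iff_growth (hg : 0 < g) (μ : YoungDiagram) (c : C.graph.Pic0) :
    c ∈ C.graph.brillNoetherLocus (C.lastPoint hg) μ ↔ ∀ b ∈ μ.cells,
      growth (fun k z => ∃ h : k < g, C.pic0Coord ⟨k, h⟩ c = (z - k) • C.posW ⟨k, h⟩) g
        (b.2 + 1) (b.1 + 1) := by
  have key (d r : ℤ) (hr : 0 ≤ r) :
      r ≤ rank (Pic0.toPic C.graph c + d • C.graph.cls (Finsupp.single (C.lastPoint hg) 1)) ↔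
      growth (fun k z => ∃ h : k < g, C.pic0Coord ⟨k, h⟩ c = (z - k) • C.posW ⟨k, h⟩) g
        (g - d + r) (r + 1) := by
    have hd : C.graph.degPic
        (Pic0.toPic C.graph c + d • C.graph.cls (Finsupp.single (C.lastPoint hg) 1)) = d := by
      rw [map_add, map_zsmul, degPic_cls, deg_single, show C.graph.degPic (Pic0.toPic _ c) = 0
        from c.2]
      simp
    have hc (i : Fin g) : C.picCoord i
        (Pic0.toPic C.graph c + d • C.graph.cls (Finsupp.single (C.lastPoint hg) 1)) =
        C.pic0Coord i c + d • C.posW i := by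
      rw [map_add, map_zsmul, coord_lastPoint]
      rfl
    rw [C.le_rank_iff_growth hg _ hr, hd]
    intro i z
    rw [hd, hc, add_smul, add_left_inj]
    exact ⟨fun h => h.2, fun h => ⟨i.2, h⟩⟩
  constructor
  · intro h b hb
    have hbox : HasBox μ (C.graph.genus - ((g : ℤ) + b.1 - (b.2 + 1)) + b.1) (b.1 + 1) :=
      ⟨b.1, b.2, hb, by rw [C.genus_graph hg]; ring, rfl⟩
    have := (key _ _ (by positivity)).1 (h _ _ hbox)
    convert this using 1
    ring
  · rintro h d r ⟨i, j, hij, hx, hy⟩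
    rw [C.genus_graph hg] at hx
    refine (key d r (by omega)).2 ?_
    rw [hx, hy]
    exact h (i, j) hij

/-- The Brill-Noether locus is the union of the tori of the displacement tableaux. -/
theorem mem_brillNoetherLocus_iff (hg : 0 < g) (μ : YoungDiagram) (c : C.graph.Pic0) :
    c ∈ C.graph.brillNoetherLocus (C.lastPoint hg) μ ↔ ∃ t : μ.cells → Fin g,
      IsDisplacementTableau C.torsion μ t ∧ c ∈ C.tableauTorus t := by
  rw [mem_brillNoetherLocus_iff_growth, forall_growth_iff]
  refine exists_congr fun t => ⟨fun ⟨hrow, hcol, hM⟩ => ?_, fun ⟨ht, hc⟩ =>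
    ⟨ht.row, ht.col, fun b => ⟨(t b).2, hc b⟩⟩⟩
  have hc : c ∈ C.tableauTorus t := fun b => (hM b).2
  refine ⟨⟨hrow, hcol, fun a b _ hab => ?_⟩, hc⟩
  -- The torsion condition is automatic: two boxes with one symbol prescribe the same coordinate of
  -- `c`.
  have h1 := hc a
  have heq : ∀ i j : Fin g, i = j → ∀ z : ℤ, C.pic0Coord j c = (z - (j : ℕ)) • C.posW j →
      C.pic0Coord i c = (z - (i : ℕ)) • C.posW i := by
    rintro i _ rfl z h
    exact h
  have h2 := heq _ _ hab _ (hc b)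
  rw [h1, zsmul_posW_eq_iff] at h2
  simpa using h2.add_right (t a : ℕ)

/-- By the torsion congruence all boxes with symbol `i` prescribe the same `i`-th coordinate; the
coordinates of omitted symbols are free. -/
theorem exists_mem_tableauTorus_iff {μ : YoungDiagram} {t : μ.cells → Fin g}
    (ht : IsDisplacementTableau C.torsion μ t) : ∃ α : Fin g → ℝ, ∀ c, c ∈ C.tableauTorus t ↔
      ∀ i ∈ range t, C.pic0Coord i c = (α i : AddCircle (C.length i)) := by
  have h (i : Fin g) : ∃ a : ℝ, ∀ b, t b = i →
      ((b.1.2 : ℤ) - b.1.1 - (i : ℕ)) • C.posW i = (a : AddCircle (C.length i)) := by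
    by_cases hi : ∃ b, t b = i
    · obtain ⟨b, rfl⟩ := hi
      obtain ⟨a, -, ha⟩ :=
        C.exists_coe_eq (t b) (((b.1.2 : ℤ) - b.1.1 - (t b : ℕ)) • C.posW (t b))
      refine ⟨a, fun b' hb' => ?_⟩
      rw [ha, zsmul_posW_eq_iff]
      by_cases hbb : b = b'
      · rw [hbb]
      · exact ((ht.torsion b b' hbb hb'.symm).symm).sub_right _
    · exact ⟨0, fun b hb => absurd ⟨b, hb⟩ hi⟩
  choose α hα using h
  refine ⟨α, fun c => ⟨?_, fun hc b => ?_⟩⟩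
  · rintro hc _ ⟨b, rfl⟩
    rw [hc b, hα _ b rfl]
  · rw [hc _ ⟨b, rfl⟩, hα _ b rfl]

theorem tableauTorus_nonempty (hg : 0 < g) {μ : YoungDiagram} {t : μ.cells → Fin g}
    (ht : IsDisplacementTableau C.torsion μ t) : (C.tableauTorus t).Nonempty := by
  obtain ⟨α, hα⟩ := C.exists_mem_tableauTorus_iff ht
  exact ⟨C.cover hg α, (hα _).2 fun i _ => C.pic0Coord_cover hg α i⟩

theorem dimH_preimage_tableauTorus_le (hg : 0 < g) {μ : YoungDiagram} {t : μ.cells → Fin g}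
    (ht : IsDisplacementTableau C.torsion μ t) :
    dimH (C.cover hg ⁻¹' C.tableauTorus t) ≤ omittedCount t := by
  obtain ⟨α, hα⟩ := C.exists_mem_tableauTorus_iff ht
  have hsub : C.cover hg ⁻¹' C.tableauTorus t ⊆
      -- The lifts of the torus form countably many parallel affine subspaces, so the dimension of
      -- the union is the supremum.
      ⋃ k : Fin g → ℤ, {y | ∀ i ∈ range t, y i = α i + k i * C.length i} := by
    intro y hy
    have h (i : Fin g) : ∃ k : ℤ, i ∈ range t → y i = α i + k * C.length i := by
      by_cases hi : i ∈ range t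
      · have := (hα _).1 hy i hi
        rw [pic0Coord_cover, ← sub_eq_zero, ← AddCircle.coe_sub, AddCircle.coe_eq_zero_iff] at this
        obtain ⟨k, hk⟩ := this
        rw [zsmul_eq_mul] at hk
        exact ⟨k, fun _ => by linarith⟩
      · exact ⟨0, fun h => absurd h hi⟩
    choose k hk using h
    exact mem_iUnion.2 ⟨k, hk⟩
  refine (dimH_mono hsub).trans ?_
  rw [dimH_iUnion]
  exact iSup_le fun k => (dimH_setOf_forall_mem_eq _ _).le

/-- The preimage of a component which meets the torus of a tableau contains an affine subspace of
the dimension of the torus. -/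
theorem exists_le_dimH_connectedComponentIn (hg : 0 < g) {μ : YoungDiagram} {t : μ.cells → Fin g}
    (ht : IsDisplacementTableau C.torsion μ t) {W : Set C.graph.Pic0} (hW : C.tableauTorus t ⊆ W) :
    ∃ c ∈ W, omittedCount t ≤ dimH (C.cover hg ⁻¹' connectedComponentIn W c) := by
  obtain ⟨α, hα⟩ := C.exists_mem_tableauTorus_iff ht
  -- One such lift is connected, so its image stays in a single component of `W`.
  set A : Set (Fin g → ℝ) := {y | ∀ i ∈ range t, y i = α i} with hA
  have hmem : ∀ y ∈ A, C.cover hg y ∈ W := fun y hy =>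
    hW ((hα _).2 fun i hi => by rw [pic0Coord_cover, hy i hi])
  refine ⟨C.cover hg α, hmem α fun _ _ => rfl, ?_⟩
  rw [omittedCount, ← dimH_setOf_forall_mem_eq (range t) α]
  refine dimH_mono (image_subset_iff.1 ?_)
  refine IsPreconnected.subset_connectedComponentIn ?_ ⟨α, fun _ _ => rfl, rfl⟩
    (image_subset_iff.2 hmem)
  exact (isPreconnected_setOf_forall_mem_eq _ _).image _
    (C.isLocalHomeomorph_cover hg).continuous.continuousOn

end ChainOfCycles

/-! ### Counting symbols, and the conclusion. -/

theorem omittedCount_add_ncard_range {g : ℕ} {μ : YoungDiagram} (t : μ.cells → Fin g) :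
    omittedCount t + (range t).ncard = g := by
  rw [omittedCount, add_comm, ncard_add_ncard_compl, Nat.card_fin]

theorem ncard_range_le_card {g : ℕ} {μ : YoungDiagram} (t : μ.cells → Fin g) :
    (range t).ncard ≤ μ.card := by
  rw [← image_univ]
  refine (ncard_image_le (toFinite _)).trans_eq ?_
  rw [ncard_univ, Nat.card_eq_fintype_card, Fintype.card_coe]

theorem ncard_range_eq_card_iff {g : ℕ} {μ : YoungDiagram} (t : μ.cells → Fin g) :
    (range t).ncard = μ.card ↔ Function.Injective t := by
  have h : μ.card = (univ : Set μ.cells).ncard := by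
    rw [ncard_univ, Nat.card_eq_fintype_card, Fintype.card_coe]
  rw [h, ← image_univ, ncard_image_iff (toFinite _), injOn_univ]

end

theorem corollary3p5 {g : ℕ} (hg : 0 < g) (C : ChainOfCycles g) (μ : YoungDiagram) :
    ((C.graph.brillNoetherLocus (C.lastPoint hg) μ).Nonempty ↔
      ∃ t : μ.cells → Fin g, IsDisplacementTableau C.torsion μ t) ∧
    ((C.graph.brillNoetherLocus (C.lastPoint hg) μ).Nonempty →
      ∃ N : ℕ, MetricGraph.HasDimension (C.graph.brillNoetherLocus (C.lastPoint hg) μ) N ∧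
        (∃ c ∈ C.graph.brillNoetherLocus (C.lastPoint hg) μ, MetricGraph.HasDimension
          (connectedComponentIn (C.graph.brillNoetherLocus (C.lastPoint hg) μ) c) N) ∧
        IsGreatest {n : ℕ | ∃ t : μ.cells → Fin g,
          IsDisplacementTableau C.torsion μ t ∧ omittedCount t = n} N ∧
        ((N : ℤ) = (g : ℤ) - μ.card ↔
          ¬ ∃ t : μ.cells → Fin g, IsDisplacementTableau C.torsion μ t ∧
            ∃ a b : μ.cells, a ≠ b ∧ t a = t b)) := by
  set W := C.graph.brillNoetherLocus (C.lastPoint hg) μ with hW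
  have hmem : ∀ c, c ∈ W ↔ ∃ t : μ.cells → Fin g,
      IsDisplacementTableau C.torsion μ t ∧ c ∈ C.tableauTorus t :=
    C.mem_brillNoetherLocus_iff hg μ
  have hne : W.Nonempty ↔ ∃ t : μ.cells → Fin g, IsDisplacementTableau C.torsion μ t := by
    refine ⟨fun ⟨c, hc⟩ => ?_, fun ⟨t, ht⟩ => ?_⟩
    · obtain ⟨t, ht, -⟩ := (hmem c).1 hc
      exact ⟨t, ht⟩
    · obtain ⟨c, hc⟩ := C.tableauTorus_nonempty hg ht
      exact ⟨c, (hmem c).2 ⟨t, ht, hc⟩⟩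
  refine ⟨hne, fun hWne => ?_⟩
  have hex := hne.1 hWne
  set S := {n : ℕ | ∃ t : μ.cells → Fin g,
    IsDisplacementTableau C.torsion μ t ∧ omittedCount t = n} with hS
  have hSne : S.Nonempty := hex.imp' _ fun t ht => ⟨t, ht, rfl⟩
  have hSbdd : BddAbove S := ⟨g, by
    rintro _ ⟨t, -, rfl⟩
    have := omittedCount_add_ncard_range t
    omega⟩
  have hmax : IsGreatest S (sSup S) := ⟨Nat.sSup_mem hSne hSbdd, fun n hn => le_csSup hSbdd hn⟩
  set N := sSup S
  obtain ⟨⟨t₀, ht₀, hN⟩, hle⟩ := hmax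
  have hdimW : dimH (C.cover hg ⁻¹' W) ≤ N := by
    have hsub : C.cover hg ⁻¹' W ⊆ ⋃ t : {t : μ.cells → Fin g //
        IsDisplacementTableau C.torsion μ t}, C.cover hg ⁻¹' C.tableauTorus t.1 := fun y hy => by
      obtain ⟨t, ht, hy⟩ := (hmem _).1 hy
      exact mem_iUnion.2 ⟨⟨t, ht⟩, hy⟩
    refine (dimH_mono hsub).trans ?_
    rw [dimH_iUnion]
    exact iSup_le fun t => (C.dimH_preimage_tableauTorus_le hg t.2).trans
      (Nat.cast_le.2 (hle ⟨t.1, t.2, rfl⟩))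
  obtain ⟨c, hcW, hc⟩ := C.exists_le_dimH_connectedComponentIn hg ht₀ (W := W)
    fun c hc => (hmem c).2 ⟨t₀, ht₀, hc⟩
  rw [hN] at hc
  have hcomp := dimH_mono (preimage_mono (f := C.cover hg) (connectedComponentIn_subset W c))
  have hcover := fun k (V : Set C.graph.Pic0) (hV : V.Nonempty)
      (h : dimH (C.cover hg ⁻¹' V) = (k : ℕ)) => (⟨hV, g, C.cover hg, C.isLocalHomeomorph_cover hg,
    C.cover_surjective hg, h⟩ : MetricGraph.HasDimension V k)
  refine ⟨N, hcover N W hWne (le_antisymm hdimW (hc.trans hcomp)), ⟨c, hcW, hcover N _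
    ⟨c, mem_connectedComponentIn hcW⟩ (le_antisymm (hcomp.trans hdimW) hc)⟩,
    ⟨⟨t₀, ht₀, hN⟩, hle⟩, ?_, ?_⟩
  -- No tableau omits more than `g - |μ|` symbols, so each uses at least `|μ|` of them and cannot
  -- repeat any.
  · rintro h ⟨t, ht, a, b, hab, htab⟩
    have h1 := hle ⟨t, ht, rfl⟩
    have h2 := omittedCount_add_ncard_range t
    have h3 := ncard_range_le_card t
    exact hab ((ncard_range_eq_card_iff t).1 (by omega) htab)
  -- The maximizing tableau `t₀` is injective, hence omits exactly `g - |μ|` symbols.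
  · intro h
    have h2 := omittedCount_add_ncard_range t₀
    have h3 := (ncard_range_eq_card_iff t₀).2 fun a b hab => by
      by_contra hne
      exact h ⟨t₀, ht₀, a, b, hne, hab⟩
    omega
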